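/- \textbf{Model.} A communicating quantum circuit with space $S$ works on $S$ qubits, initially all in state $|0\rangle$; at every moment each qubit is held by one of two players, Alice and Bob. It is a fixed sequence of gates: a player applies an arbitrary unitary to qubits that the player holds, reads a single bit of the own input into such a qubit by an oracle gate (possibly in superposition), or measures such a qubit; a qubit is thrown away and either player picks up a fresh qubit in state $|0\rangle$ in its place; a qubit is sent to the other player; or a player measures a register of held qubits, the result is one of the outputs, and the register is sent to the other player. Each output is produced by exactly one output gate, at a predetermined point. The communication of the circuit is the number of qubits that cross between the players (including the output registers). A protocol is deterministic if all its unitary gates are permutations of the computational basis and its outputs are correct with probability $1$. It has error at most $\varepsilon$ if on every input all outputs are simultaneously correct with probability at least $1-\varepsilon$. For a finite field $F$, elements are written with $\lceil\log|F|\rceil$ bits by an arbitrary injective encoding ($\log=\log_2$). In the problem $IP^F_{l,r}$ Alice gets $x_1,\dots,x_l\in F^n$, Bob gets $y_1,\dots,y_r\in F^n$, and the outputs are the $lr$ inner products $\sum_{t=1}^n x_{i,t}\,y_{j,t}\in F$. So $IP^F_{n,n}$ is multiplication of two $n\times n$ matrices and $IP^F_{n,1}$ is the matrix-vector product. \textbf{Statement.}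 There are absolute constants $c\in\mathbb N$ and $K>0$, and for every $\varepsilon\in[0,1/2)$ there is a constant $\delta>0$ depending only on $\varepsilon$, such that for all finite fields $F$, all encodings, and all integers $n\ge 1$, $S\ge 1$ with $\log n\le S\le n\log|F|$ the following holds. (1) $IP^F_{n,n}$ can be computed by a deterministic protocol with space $\max\{S,\,c\lceil\log|F|\rceil\}$ (hence with space $S$ whenever $S\ge c\lceil\log|F|\rceil$) and communication at most $K\,n^3\log^2|F|/S$, and every quantum protocol with space $S$ and error at most $\varepsilon$ for $IP^F_{n,n}$ needs communication at least $\delta\,n^3\log^2|F|/S$. (2) $IP^F_{n,1}$ can be computed by a deterministic protocol with space $\max\{S,\,c\lceil\log|F|\rceil\}$ and communication at most $K\,n^2\log^2|F|/S$, and every quantum protocol with space $S$ and error at most $\varepsilon$ for $IP^F_{n,1}$ needs communication at least $\delta\,n^2\log^2|F|/S$. -/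

import Mathlib

/-! Communicating quantum circuits. A circuit works on a pool of `S` qubits. At every moment each
qubit is held by one of the two players. Gates are performed in a fixed order, so every output is
produced at a predetermined point. -/

/-- The two players. -/
inductive Player where
  | alice
  | bob
  deriving DecidableEq

namespace Player

/-- The opponent of a player. -/
def other : Player → Player
  | alice => bob
  | bob => alice

end Player

/-- Labels of the computational basis states of `S` qubits. -/
abbrev BasisLabel (S : ℕ) := Fin S → Bool

/-- (Unnormalized) density matrices on `S` qubits. -/
abbrev QState (S : ℕ) := Matrix (BasisLabel S) (BasisLabel S) ℂ

/-- The gates of a communicating circuit on `S` qubits. The input of player `P` is a bit string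
with positions in `Idx P`; the outputs are labelled by `ω`, and each is a string of `L` bits. -/
inductive CommGate (S : ℕ) (Idx : Player → Type) (ω : Type) (L : ℕ) : Type where
  /-- Player `P` applies the unitary `V` to the set `D` of qubits. -/
  | unitary (P : Player) (D : Finset (Fin S)) (V : Matrix.unitaryGroup (D → Bool) ℂ)
  /-- Player `P` reads a single bit of the input by an oracle gate: the bit at the position given
  by the content of the qubits in `D` is XORed into the qubit `t` (for the value `none`,
  nothing is read). -/
  | query (P : Player) (t : Fin S) (D : Finset (Fin S)) (addr : (D → Bool) → Option (Idx P))
  /-- Player `P` measures the qubit `q` in the computational basis. -/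
  | measure (P : Player) (q : Fin S)
  /-- The qubit `q` is thrown away, and player `P` picks up a fresh qubit in state `0` instead. -/
  | fresh (P : Player) (q : Fin S)
  /-- The holder of the qubit `q` sends it to the other player. -/
  | send (q : Fin S)
  /-- Player `P` measures the register `reg` of `L` qubits; the result is the output labelled
  `k`, and it is sent to the other player. -/
  | output (P : Player) (reg : Fin L ↪ Fin S) (k : ω)

namespace CommGate

variable {S : ℕ} {Idx : Player → Type} {ω : Type} {L : ℕ}

/-- A player may operate only on qubits that the player holds (`own q` is the holder of `q`). -/
def Legal (own : Fin S → Player) : CommGate S Idx ω L → Prop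
  | unitary P D _ => ∀ q ∈ D, own q = P
  | query P t D _ => own t = P ∧ t ∉ D ∧ ∀ q ∈ D, own q = P
  | measure P q => own q = P
  | fresh _ _ => True
  | send _ => True
  | output P reg _ => ∀ b, own (reg b) = P

/-- Who holds which qubit after the gate. -/
noncomputable def newOwner (own : Fin S → Player) : CommGate S Idx ω L → Fin S → Player
  | unitary _ _ _ => own
  | query _ _ _ _ => own
  | measure _ _ => own
  | fresh P q => Function.update own q P
  | send q => Function.update own q (own q).other
  | output P reg _ => fun q => open Classical in if q ∈ Set.range reg then P.other else own q

/-- The number of qubits that cross between the players at the gate. -/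
def cost : CommGate S Idx ω L → ℕ
  | send _ => 1
  | output _ _ _ => L
  | _ => 0

/-- The label of the output that is produced at the gate, if there is one. -/
def outputLabel : CommGate S Idx ω L → Option ω
  | output _ _ k => some k
  | _ => none

/-- Classical gates: every local unitary is a permutation of the computational basis. -/
def IsClassical : CommGate S Idx ω L → Prop
  | unitary _ D V =>
      ∃ σ : Equiv.Perm (D → Bool), (V : Matrix (D → Bool) (D → Bool) ℂ) = σ.permMatrix ℂ
  | _ => True

/-- The operator `V ⊗ 1` on `S` qubits, where `V` acts on the qubits in `D`. -/
def extend (D : Finset (Fin S)) (V : Matrix (D → Bool) (D → Bool) ℂ) : QState S :=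
  fun z w => if ∀ q, q ∉ D → z q = w q then V (fun q => z q) (fun q => w q) else 0

/-- The action of an oracle gate on basis states, for the input string `x`. -/
def queryLabel {ι : Type} (x : ι → Bool) (t : Fin S) (D : Finset (Fin S))
    (addr : (D → Bool) → Option ι) (z : BasisLabel S) : BasisLabel S :=
  Function.update z t (xor (z t) ((addr fun q => z q).elim false x))

/-- The unitary operator of an oracle gate. -/
def queryMatrix {ι : Type} (x : ι → Bool) (t : Fin S) (D : Finset (Fin S))
    (addr : (D → Bool) → Option ι) : QState S :=
  fun z w => if z = queryLabel x t D addr w then 1 else 0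

/-- The effect of a gate on the state of all qubits, for the inputs `x`. At an output gate with
label `k` the state is projected to the event that the result of the measurement is `o k`,
without renormalization. -/
def act (x : ∀ P, Idx P → Bool) (o : ω → Fin L → Bool) :
    CommGate S Idx ω L → QState S → QState S
  | unitary _ D V, ρ => extend D V.1 * ρ * (extend D V.1).conjTranspose
  | query P t D addr, ρ =>
      queryMatrix (x P) t D addr * ρ * (queryMatrix (x P) t D addr).conjTranspose
  | measure _ q, ρ => fun z w => if z q = w q then ρ z w else 0
  | fresh _ q, ρ => fun z w =>
      if z q = false ∧ w q = false then
        ∑ b : Bool, ρ (Function.update z q b) (Function.update w q b)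
      else 0
  | send _, ρ => ρ
  | output _ reg k, ρ => fun z w =>
      if (∀ b, z (reg b) = o k b) ∧ (∀ b, w (reg b) = o k b) then ρ z w else 0

/-- All gates of the list are legal when they are performed one after the other. -/
def LegalFrom : (Fin S → Player) → List (CommGate S Idx ω L) → Prop
  | _, [] => True
  | own, g :: gs => g.Legal own ∧ LegalFrom (g.newOwner own) gs

end CommGate

/-- A quantum protocol with space `S`: a communicating quantum circuit on `S` qubits that produces
every output exactly once. -/
structure QProtocol (S : ℕ) (Idx : Player → Type) (ω : Type) (L : ℕ) where
  /-- Who holds which qubit at the beginning. -/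
  owner : Fin S → Player
  /-- The gates, in the order in which they are performed. -/
  gates : List (CommGate S Idx ω L)
  legal : CommGate.LegalFrom owner gates
  nodup_outputs : (gates.filterMap CommGate.outputLabel).Nodup
  mem_outputs : ∀ k, k ∈ gates.filterMap CommGate.outputLabel

namespace QProtocol

variable {S : ℕ} {Idx : Player → Type} {ω : Type} {L : ℕ}

/-- The communication: the number of qubits that cross between the players. -/
def communication (π : QProtocol S Idx ω L) : ℕ := (π.gates.map CommGate.cost).sum

/-- Deterministic protocols: all gates are classical. -/
def IsDeterministic (π : QProtocol S Idx ω L) : Prop := ∀ g ∈ π.gates, g.IsClassical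

/-- All qubits are in state `0`. -/
def initialState (S : ℕ) : QState S :=
  Matrix.single (fun _ => false) (fun _ => false) 1

/-- The probability that on the inputs `x` the protocol outputs `o k` for all labels `k`. -/
def outputProb (π : QProtocol S Idx ω L) (x : ∀ P, Idx P → Bool) (o : ω → Fin L → Bool) : ℝ :=
  (Matrix.trace (π.gates.foldl (fun ρ g => g.act x o ρ) (initialState S))).re

end QProtocol

/-! Inner products over a finite field. -/

/-- The number of bits that are used for an element of `F`. -/
def elemBits (F : Type*) [Fintype F] : ℕ := Nat.clog 2 (Fintype.card F)

/-- Positions in the inputs: Alice holds `l` vectors and Bob `r` vectors with `n` entries of `L`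
bits each. -/
def InputPos (n l r L : ℕ) : Player → Type
  | .alice => Fin l × Fin n × Fin L
  | .bob => Fin r × Fin n × Fin L

/-- The two inputs, written in binary by the encoding `e`. -/
def inputBits {F : Type*} {n l r L : ℕ} (e : F → Fin L → Bool)
    (x : Fin l → Fin n → F) (y : Fin r → Fin n → F) : ∀ P, InputPos n l r L P → Bool
  | .alice => fun p => e (x p.1 p.2.1) p.2.2
  | .bob => fun p => e (y p.1 p.2.1) p.2.2

/-- Protocols with space `S` for a problem in which Alice holds `l` vectors and Bob holds `r`
vectors in `F ^ n`, and there is an output in `F` for every pair of their vectors. -/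
abbrev PairProtocol (F : Type*) [Fintype F] (n l r S : ℕ) :=
  QProtocol S (InputPos n l r (elemBits F)) (Fin l × Fin r) (elemBits F)

/-- The inner product over `F`. -/
def innerProd {F : Type*} [Field F] {n : ℕ} (x y : Fin n → F) : F := ∑ i, x i * y i

/-- On all inputs, with probability at least `p`, all the `l * r` inner products that the protocol
outputs are correct. -/
def PairProtocol.Computes {F : Type*} [Field F] [Fintype F] {n l r S : ℕ}
    (π : PairProtocol F n l r S) (e : F ↪ (Fin (elemBits F) → Bool)) (p : ℝ) : Prop :=
  ∀ (x : Fin l → Fin n → F) (y : Fin r → Fin n → F),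
    p ≤ π.outputProb (inputBits e x y) (fun k => e (innerProd (x k.1) (y k.2)))

/-!
The upper bounds are block algorithms. Alice keeps about `S / (2 log |F|)` accumulators for the
inner products of as many of her vectors with one vector of Bob, who sends the entries of this
vector one by one; for the next block of accumulators everything is sent again. Matrix
multiplication repeats this for every vector of Bob.

The lower bounds cut the circuit into segments that produce `k` outputs each, for `k log |F|`
slightly above `S`. All segments must communicate `Ω (n log |F|)` qubits, and this gives the bounds
(if `S` is itself of the order of `n log |F|`, then the outputs alone cost enough). Indeed, the
state at the start of a segment is at most the identity operator, so the segment would be at least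
as successful, up to normalization, if it started from the identity instead, which has trace `2 ^ S`
and does not depend on the inputs (`trace_run_segment_le`). The probability that the outputs are
correct is expanded in the characters of `F ^ k` (`le_of_forall_le_trace_run`). The trivial
character contributes at most `2 ^ S / |F| ^ k`, because the probabilities of all outcomes add up to
at most `1`. Every other character of the outputs is a character of a bilinear form of rank at least
`n` in the inputs, with bias at most `|F| ^ (-n / 2)` by Lindsey's lemma
(`norm_sum_sum_addChar_le`).

The link between bias and communication is `norm_sum_trace_run_le`. It follows a tensor product of a
positive operator that depends on the input of Alice and one that depends on the input of Bob. Local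
gates preserve this form and do not increase the traces; an output gate leaves a register in a known
basis state, which may be handed over; and sending a qubit is the same as a signed combination of
six maps that measure the qubit in unit vectors and prepare a new one (`eq_sum_scaleBy_bracket`). So
`q` qubits of communication cost a factor of at most `8 ^ q`. As everything is expressed with
positive maps and traces, no other norm has to be controlled under the unbounded number of
measurements and fresh qubits.
-/

/-! ### Gates as positive, trace-nonincreasing linear maps -/

namespace CommGate

section LinearAlgebra

open Matrix
open scoped ComplexOrder

variable {S : ℕ} {Idx : Player → Type} {ω : Type} {L : ℕ}

/-- Conjugation of an operator by the diagonal matrix with entries `v`. -/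
def scaleBy (v : BasisLabel S → ℂ) (ρ : QState S) : QState S :=
  fun z w => v z * ρ z w * star (v w)

lemma scaleBy_posSemidef (v : BasisLabel S → ℂ) {ρ : QState S} (h : ρ.PosSemidef) :
    (scaleBy v ρ).PosSemidef := by
  have : scaleBy v ρ = diagonal v * ρ * (diagonal v)ᴴ := by
    ext z w; simp [scaleBy, diagonal_conjTranspose]
  rw [this]
  exact h.mul_mul_conjTranspose_same _

lemma scaleBy_add (v : BasisLabel S → ℂ) (ρ σ : QState S) :
    scaleBy v (ρ + σ) = scaleBy v ρ + scaleBy v σ := by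
  ext z w
  change v z * (ρ z w + σ z w) * star (v w) = v z * ρ z w * star (v w) + v z * σ z w * star (v w)
  ring

lemma scaleBy_smul (v : BasisLabel S → ℂ) (c : ℂ) (ρ : QState S) :
    scaleBy v (c • ρ) = c • scaleBy v ρ := by
  ext z w
  change v z * (c * ρ z w) * star (v w) = c * (v z * ρ z w * star (v w))
  ring

lemma trace_scaleBy (v : BasisLabel S → ℂ) (ρ : QState S) :
    (scaleBy v ρ).trace = ∑ z, v z * ρ z z * star (v z) := rfl

/-- Basis label `z` with the qubits in `D` replaced by `c`. -/
def override (D : Finset (Fin S)) (c : D → Bool) (z : BasisLabel S) : BasisLabel S :=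
  fun q => if h : q ∈ D then c ⟨q, h⟩ else z q

lemma override_of_mem {D : Finset (Fin S)} (c : D → Bool) (z : BasisLabel S) (q : D) :
    override D c z q = c q := by
  simp [override]

lemma override_of_notMem {D : Finset (Fin S)} (c : D → Bool) (z : BasisLabel S) {q : Fin S}
    (h : q ∉ D) : override D c z q = z q := by
  simp [override, h]

lemma sum_extend_mul (D : Finset (Fin S)) (V : Matrix (D → Bool) (D → Bool) ℂ)
    (z : BasisLabel S) (f : BasisLabel S → ℂ) :
    ∑ u, extend D V z u * f u = ∑ c, V (fun q => z q) c * f (override D c z) := by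
  simp only [extend, ite_mul, zero_mul]
  rw [← Finset.sum_filter]
  refine Finset.sum_nbij' (fun u q => u q) (fun c => override D c z) (by simp) ?_ ?_ ?_ ?_
  · intro c _
    simp only [Finset.mem_filter, Finset.mem_univ, true_and]
    intro q hq
    rw [override_of_notMem _ _ hq]
  · intro u hu
    simp only [Finset.mem_filter, Finset.mem_univ, true_and] at hu
    ext q
    by_cases h : q ∈ D
    · simp [override, h]
    · simp [override, h, hu q h]
  · intro c _
    ext q
    exact override_of_mem _ _ _
  · intro u hu
    simp only [Finset.mem_filter, Finset.mem_univ, true_and] at hu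
    congr 2
    ext q
    by_cases h : q ∈ D
    · simp [override, h]
    · simp [override, h, hu q h]

lemma extend_conjTranspose (D : Finset (Fin S)) (V : Matrix (D → Bool) (D → Bool) ℂ) :
    (extend D V)ᴴ = extend D Vᴴ := by
  ext z w
  simp only [conjTranspose_apply, extend, apply_ite star, star_zero, eq_comm (a := z _)]

lemma extend_conj_apply (D : Finset (Fin S)) (V : Matrix (D → Bool) (D → Bool) ℂ)
    (ρ : QState S) (z w : BasisLabel S) :
    (extend D V * ρ * (extend D V)ᴴ) z w =
      ∑ c, ∑ c', V (fun q => z q) c * ρ (override D c z) (override D c' w) *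
        star (V (fun q => w q) c') := by
  have h (v : BasisLabel S) :
      (extend D V * ρ) z v = ∑ c, V (fun q => z q) c * ρ (override D c z) v := by
    rw [mul_apply, sum_extend_mul D V z (fun u => ρ u v)]
  have h2 : ∑ v, (extend D V * ρ) z v * (extend D V)ᴴ v w =
      star (∑ v, extend D V w v * star ((extend D V * ρ) z v)) := by
    rw [star_sum]
    refine Finset.sum_congr rfl fun v _ => ?_
    rw [conjTranspose_apply, star_mul, star_star]
  rw [mul_apply, h2, sum_extend_mul D V w (fun v => star ((extend D V * ρ) z v)), star_sum,
    Finset.sum_comm]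
  refine Finset.sum_congr rfl fun c' _ => ?_
  rw [star_mul, star_star, h, Finset.sum_mul]

lemma extend_conjTranspose_mul_self (D : Finset (Fin S)) (V : Matrix.unitaryGroup (D → Bool) ℂ) :
    (extend D V.1)ᴴ * extend D V.1 = 1 := by
  ext z w
  have hV : (V.1)ᴴ * V.1 = 1 := Matrix.mem_unitaryGroup_iff'.1 V.2
  rw [extend_conjTranspose, mul_apply, sum_extend_mul D _ z (fun u => extend D V.1 u w)]
  have h1 (c : D → Bool) : extend D V.1 (override D c z) w =
      if ∀ q, q ∉ D → z q = w q then V.1 c (fun q => w q) else 0 := by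
    have : (fun q : D => override D c z q) = c := by ext q; exact override_of_mem _ _ _
    simp only [extend, this]
    congr 1
    refine propext (forall_congr' fun q => forall_congr' fun hq => ?_)
    rw [override_of_notMem _ _ hq]
  simp only [h1, mul_ite, mul_zero]
  have h2 := congrFun (congrFun hV (fun q => z q)) (fun q => w q)
  rw [mul_apply] at h2
  by_cases hzw : ∀ q, q ∉ D → z q = w q
  · simp only [if_pos hzw]
    rw [h2, one_apply, one_apply]
    congr 1
    refine propext ⟨fun h => ?_, fun h => by rw [h]⟩
    ext q
    by_cases hq : q ∈ D
    · exact congrFun h ⟨q, hq⟩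
    · exact hzw q hq
  · rw [one_apply_ne (fun h => hzw (by simp [h]))]
    simp only [if_neg hzw, Finset.sum_const_zero]

lemma queryLabel_involutive {ι : Type} (x : ι → Bool) {t : Fin S} {D : Finset (Fin S)}
    (addr : (D → Bool) → Option ι) (ht : t ∉ D) :
    Function.Involutive (queryLabel x t D addr) := by
  intro z
  have h : (fun q : D => queryLabel x t D addr z q) = fun q : D => z q := by
    ext q
    have : (q : Fin S) ≠ t := fun h => ht (h ▸ q.2)
    simp [queryLabel, Function.update_of_ne this]
  have h2 : queryLabel x t D addr z t = xor (z t) ((addr fun q => z q).elim false x) := by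
    simp [queryLabel]
  ext q
  by_cases hq : q = t
  · subst hq
    rw [queryLabel, Function.update_self, h, h2, Bool.xor_assoc, Bool.xor_self, Bool.xor_false]
  · rw [queryLabel, Function.update_of_ne hq, queryLabel, Function.update_of_ne hq]

lemma queryMatrix_conj {ι : Type} (x : ι → Bool) {t : Fin S} {D : Finset (Fin S)}
    (addr : (D → Bool) → Option ι) (ht : t ∉ D) (ρ : QState S) :
    queryMatrix x t D addr * ρ * (queryMatrix x t D addr)ᴴ =
      ρ.submatrix (queryLabel x t D addr) (queryLabel x t D addr) := by
  have hi := queryLabel_involutive x addr ht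
  have e (z u : BasisLabel S) :
      queryMatrix x t D addr z u = if queryLabel x t D addr z = u then 1 else 0 := by
    simp only [queryMatrix]
    congr 1
    exact propext ⟨fun h => by rw [h, hi], fun h => by rw [← h, hi]⟩
  ext z w
  simp [mul_apply, e, apply_ite star]

lemma sum_update_of_eq {M : Type*} [AddCommMonoid M] (q : Fin S) (b : Bool)
    (f : BasisLabel S → M) :
    (∑ z, if z q = false then f (Function.update z q b) else 0) =
      ∑ z, if z q = b then f z else 0 := by
  rw [← Finset.sum_filter, ← Finset.sum_filter]
  refine Finset.sum_nbij' (fun z => Function.update z q b) (fun z => Function.update z q false)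
    (by simp) (by simp) ?_ ?_ (by simp) <;>
  · intro z hz
    simp only [Finset.mem_filter, Finset.mem_univ, true_and] at hz
    rw [Function.update_idem, ← hz, Function.update_eq_self]

lemma sum_sum_update {M : Type*} [AddCommMonoid M] (q : Fin S) (f : BasisLabel S → M) :
    (∑ z, if z q = false then ∑ b : Bool, f (Function.update z q b) else 0) = ∑ z, f z := by
  have h (z : BasisLabel S) : (if z q = false then ∑ b : Bool, f (Function.update z q b) else 0) =
      ∑ b : Bool, if z q = false then f (Function.update z q b) else 0 := by
    split_ifs <;> simp
  simp only [h]
  rw [Finset.sum_comm]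
  simp only [sum_update_of_eq]
  rw [Finset.sum_comm]
  simp

/-- Partial trace over the qubit `q`, as an operator that does not depend on `q`. -/
def partialTrace (q : Fin S) (ρ : QState S) : QState S :=
  fun z w => ∑ b : Bool, ρ (Function.update z q b) (Function.update w q b)

lemma partialTrace_add (q : Fin S) (ρ σ : QState S) :
    partialTrace q (ρ + σ) = partialTrace q ρ + partialTrace q σ := by
  ext z w
  exact Finset.sum_add_distrib

lemma partialTrace_smul (q : Fin S) (c : ℂ) (ρ : QState S) :
    partialTrace q (c • ρ) = c • partialTrace q ρ := by
  ext z w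
  exact (Finset.mul_sum _ _ _).symm

lemma partialTrace_posSemidef (q : Fin S) {ρ : QState S} (h : ρ.PosSemidef) :
    (partialTrace q ρ).PosSemidef := by
  have : partialTrace q ρ =
      ∑ b : Bool, ρ.submatrix (Function.update · q b) (Function.update · q b) := by
    ext z w
    simp [partialTrace]
  rw [this]
  exact posSemidef_sum _ fun b _ => h.submatrix _

/-- The indicator of the event that the qubit `q` has the value `b`. -/
def bitInd (q : Fin S) (b : Bool) (z : BasisLabel S) : ℂ := if z q = b then 1 else 0

/-- The indicator of the event that the register `reg` has the value `c`. -/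
def regInd (reg : Fin L ↪ Fin S) (c : Fin L → Bool) (z : BasisLabel S) : ℂ :=
  if ∀ b, z (reg b) = c b then 1 else 0

variable (x : ∀ P, Idx P → Bool) (o : ω → Fin L → Bool)

lemma act_measure (P : Player) (q : Fin S) (ρ : QState S) :
    (measure P q : CommGate S Idx ω L).act x o ρ = ∑ b : Bool, scaleBy (bitInd q b) ρ := by
  ext z w
  cases hz : z q <;> cases hw : w q <;> simp [act, scaleBy, bitInd, hz, hw]

lemma act_fresh (P : Player) (q : Fin S) (ρ : QState S) :
    (fresh P q : CommGate S Idx ω L).act x o ρ = scaleBy (bitInd q false) (partialTrace q ρ) := by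
  ext z w
  cases hz : z q <;> cases hw : w q <;> simp [act, scaleBy, bitInd, partialTrace, hz, hw]

lemma act_output (P : Player) (reg : Fin L ↪ Fin S) (k : ω) (ρ : QState S) :
    (output P reg k : CommGate S Idx ω L).act x o ρ = scaleBy (regInd reg (o k)) ρ := by
  ext z w
  by_cases hz : ∀ b, z (reg b) = o k b <;> by_cases hw : ∀ b, w (reg b) = o k b <;>
    simp [act, scaleBy, regInd, hz, hw]

/-- A gate as a linear map on operators. -/
def actLin (g : CommGate S Idx ω L) : QState S →ₗ[ℂ] QState S where
  toFun := g.act x o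
  map_add' ρ σ := by
    cases g with
    | unitary P D V => simp [act, mul_add, add_mul]
    | query P t D addr => simp [act, mul_add, add_mul]
    | measure P q => simp only [act_measure, scaleBy_add, Finset.sum_add_distrib]
    | fresh P q => simp only [act_fresh, scaleBy_add, partialTrace_add]
    | send q => rfl
    | output P reg k => simp only [act_output, scaleBy_add]
  map_smul' c ρ := by
    cases g with
    | unitary P D V => simp [act]
    | query P t D addr => simp [act]
    | measure P q => simp only [act_measure, scaleBy_smul, Finset.smul_sum, RingHom.id_apply]
    | fresh P q => simp only [act_fresh, scaleBy_smul, partialTrace_smul, RingHom.id_apply]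
    | send q => rfl
    | output P reg k => simp only [act_output, scaleBy_smul, RingHom.id_apply]

/-- A list of gates as a linear map on operators. -/
def run : List (CommGate S Idx ω L) → QState S →ₗ[ℂ] QState S
  | [] => LinearMap.id
  | g :: gs => run gs ∘ₗ actLin x o g

lemma run_nil (ρ : QState S) : run x o ([] : List (CommGate S Idx ω L)) ρ = ρ := rfl

lemma run_cons (g : CommGate S Idx ω L) (gs : List (CommGate S Idx ω L)) (ρ : QState S) :
    run x o (g :: gs) ρ = run x o gs (g.act x o ρ) := rfl

lemma run_eq_foldl (gs : List (CommGate S Idx ω L)) (ρ : QState S) :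
    run x o gs ρ = gs.foldl (fun ρ g => g.act x o ρ) ρ := by
  induction gs generalizing ρ with
  | nil => rfl
  | cons g gs ih => rw [run_cons, ih, List.foldl_cons]

lemma run_append (gs hs : List (CommGate S Idx ω L)) (ρ : QState S) :
    run x o (gs ++ hs) ρ = run x o hs (run x o gs ρ) := by
  simp [run_eq_foldl]

lemma act_posSemidef (g : CommGate S Idx ω L) {ρ : QState S} (h : ρ.PosSemidef) :
    (g.act x o ρ).PosSemidef := by
  cases g with
  | unitary P D V => exact h.mul_mul_conjTranspose_same _
  | query P t D addr => exact h.mul_mul_conjTranspose_same _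
  | measure P q =>
    rw [act_measure]
    exact posSemidef_sum _ fun b _ => scaleBy_posSemidef _ h
  | fresh P q =>
    rw [act_fresh]
    exact scaleBy_posSemidef _ (partialTrace_posSemidef _ h)
  | send q => exact h
  | output P reg k =>
    rw [act_output]
    exact scaleBy_posSemidef _ h

lemma run_posSemidef (gs : List (CommGate S Idx ω L)) {ρ : QState S} (h : ρ.PosSemidef) :
    (run x o gs ρ).PosSemidef := by
  induction gs generalizing ρ with
  | nil => exact h
  | cons g gs ih => exact ih (act_posSemidef x o g h)

lemma trace_re_nonneg {ρ : QState S} (h : ρ.PosSemidef) : 0 ≤ ρ.trace.re :=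
  (Complex.le_def.1 h.trace_nonneg).1

lemma trace_eq_re {ρ : QState S} (h : ρ.PosSemidef) : ρ.trace = (ρ.trace.re : ℂ) := by
  have := (Complex.le_def.1 h.trace_nonneg).2
  apply Complex.ext <;> simp_all

lemma diag_re_nonneg {ρ : QState S} (h : ρ.PosSemidef) (z : BasisLabel S) : 0 ≤ (ρ z z).re :=
  (Complex.le_def.1 (h.diag_nonneg (i := z))).1

lemma trace_act_fresh (P : Player) (q : Fin S) (ρ : QState S) :
    ((fresh P q : CommGate S Idx ω L).act x o ρ).trace = ρ.trace := by
  calc _ = ∑ z, if z q = false then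
        ∑ b : Bool, ρ (Function.update z q b) (Function.update z q b) else 0 := by
        refine Finset.sum_congr rfl fun z _ => ?_
        change (if z q = false ∧ z q = false then _ else _) = _
        simp only [and_self]
    _ = _ := sum_sum_update q fun z => ρ z z

lemma trace_act_le {own : Fin S → Player} {g : CommGate S Idx ω L} (hg : g.Legal own)
    {ρ : QState S} (h : ρ.PosSemidef) : (g.act x o ρ).trace.re ≤ ρ.trace.re := by
  cases g with
  | unitary P D V =>
    simp only [act]
    rw [trace_mul_comm, ← Matrix.mul_assoc, extend_conjTranspose_mul_self, Matrix.one_mul]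
  | query P t D addr =>
    have hi := queryLabel_involutive (x P) addr hg.2.1
    simp only [act]
    rw [queryMatrix_conj (x P) addr hg.2.1]
    exact (congrArg Complex.re (Equiv.sum_comp hi.toPerm fun z => ρ z z)).le
  | measure P q =>
    refine (congrArg Complex.re (Finset.sum_congr rfl fun z _ => ?_)).le
    exact if_pos rfl
  | fresh P q => rw [trace_act_fresh]
  | send q => exact le_rfl
  | output P reg k =>
    simp only [trace, Complex.re_sum]
    refine Finset.sum_le_sum fun z _ => ?_
    change (if _ then ρ z z else 0 : ℂ).re ≤ (ρ z z).re
    split_ifs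
    · exact le_rfl
    · exact diag_re_nonneg h z

lemma trace_run_le {own : Fin S → Player} {gs : List (CommGate S Idx ω L)}
    (hg : LegalFrom own gs) {ρ : QState S} (h : ρ.PosSemidef) :
    (run x o gs ρ).trace.re ≤ ρ.trace.re := by
  induction gs generalizing ρ own with
  | nil => exact le_rfl
  | cons g gs ih =>
    exact (ih hg.2 (act_posSemidef x o g h)).trans (trace_act_le x o hg.1 h)

/-- The owners of the qubits after a list of gates. -/
noncomputable def ownerAfter (own : Fin S → Player) (gs : List (CommGate S Idx ω L)) :
    Fin S → Player :=
  gs.foldl (fun own g => g.newOwner own) own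

lemma legalFrom_append {own : Fin S → Player} {gs hs : List (CommGate S Idx ω L)} :
    LegalFrom own (gs ++ hs) ↔ LegalFrom own gs ∧ LegalFrom (ownerAfter own gs) hs := by
  induction gs generalizing own with
  | nil => simp [LegalFrom, ownerAfter]
  | cons g gs ih => simp [LegalFrom, ownerAfter, ih, and_assoc]

/-- A state of trace at most `1` is at most the identity. -/
lemma one_sub_posSemidef {ρ : QState S} (h : ρ.PosSemidef) (ht : ρ.trace.re ≤ 1) :
    (1 - ρ).PosSemidef := by
  have hH := h.isHermitian
  have hle (i : BasisLabel S) : hH.eigenvalues i ≤ 1 := by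
    have h1 : ρ.trace.re = ∑ i, hH.eigenvalues i := by
      rw [hH.trace_eq_sum_eigenvalues]; simp
    rw [h1] at ht
    exact (Finset.single_le_sum (fun j _ => h.eigenvalues_nonneg j) (Finset.mem_univ i)).trans ht
  have hs := hH.spectral_theorem
  set U := hH.eigenvectorUnitary
  have hU : (U : QState S) * star (U : QState S) = 1 := Matrix.mem_unitaryGroup_iff.1 U.2
  have : 1 - ρ = (U : Matrix _ _ ℂ) * diagonal (fun i => (1 : ℂ) - hH.eigenvalues i) *
      (U : Matrix _ _ ℂ)ᴴ := by
    have hd : diagonal (fun i => (1 : ℂ) - hH.eigenvalues i) =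
        1 - diagonal (RCLike.ofReal ∘ hH.eigenvalues) := by
      ext i j
      by_cases hij : i = j
      · subst hij; simp
      · simp [hij]
    rw [← star_eq_conjTranspose, hd, Matrix.mul_sub, Matrix.sub_mul, Matrix.mul_one, hU]
    conv_lhs => rw [hs]
    simp [Unitary.conjStarAlgAut_apply, star_eq_conjTranspose]
  rw [this]
  refine PosSemidef.mul_mul_conjTranspose_same (PosSemidef.diagonal fun i => ?_) _
  have := hle i
  simp only [Pi.zero_apply]
  rw [← Complex.ofReal_one, ← Complex.ofReal_sub, Complex.zero_le_real]
  linarith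

/-- A segment of a circuit that starts in an arbitrary state of trace at most `1` is at most as
successful as the segment that starts in the identity operator, which does not depend on the
inputs. -/
lemma trace_run_segment_le {own : Fin S → Player} {pre seg post : List (CommGate S Idx ω L)}
    (hg : LegalFrom own (pre ++ seg ++ post)) {ρ : QState S} (h : ρ.PosSemidef)
    (ht : ρ.trace.re ≤ 1) :
    (run x o (pre ++ seg ++ post) ρ).trace.re ≤ (run x o seg 1).trace.re := by
  rw [legalFrom_append, legalFrom_append] at hg
  rw [run_append, run_append]
  refine (trace_run_le x o hg.2 (run_posSemidef x o _ (run_posSemidef x o _ h))).trans ?_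
  have h1 := run_posSemidef x o seg
    (one_sub_posSemidef (run_posSemidef x o pre h) ((trace_run_le x o hg.1.1 h).trans ht))
  have h2 := trace_re_nonneg h1
  rw [map_sub, trace_sub, Complex.sub_re] at h2
  linarith

end LinearAlgebra

end CommGate

/-! ### Circuits that act on product states -/

namespace CommGate

section ProductStates

open Matrix
open scoped ComplexOrder

variable {S : ℕ} {Idx : Player → Type} {ω : Type} {L : ℕ}

/-- The operator `ρ` depends only on the qubits in `V`: it is the tensor product of an operator on
these qubits and the all-ones matrix on the others. With this encoding the tensor product of
operators on complementary sets of qubits is an entrywise product. -/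
def IsLocal (V : Set (Fin S)) (ρ : QState S) : Prop :=
  ∀ ⦃z z' w w' : BasisLabel S⦄, (∀ q ∈ V, z q = z' q) → (∀ q ∈ V, w q = w' q) → ρ z w = ρ z' w'

lemma IsLocal.mono {V W : Set (Fin S)} {ρ : QState S} (h : IsLocal V ρ) (hVW : V ⊆ W) :
    IsLocal W ρ :=
  fun _ _ _ _ hz hw => h (fun q hq => hz q (hVW hq)) fun q hq => hw q (hVW hq)

/-- Functions of disjoint sets of bits are independent. -/
lemma sum_mul_of_dependsOn {f g : BasisLabel S → ℂ} {V : Set (Fin S)} (hf : DependsOn f V)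
    (hg : DependsOn g Vᶜ) : (∑ z, f z) * ∑ z, g z = 2 ^ S * ∑ z, f z * g z := by
  classical
  let mix (z z' : BasisLabel S) : BasisLabel S := fun q => if q ∈ V then z q else z' q
  let e : BasisLabel S × BasisLabel S ≃ BasisLabel S × BasisLabel S :=
    Function.Involutive.toPerm (fun p => (mix p.1 p.2, mix p.2 p.1)) (by
      rintro ⟨z, z'⟩
      refine Prod.ext ?_ ?_ <;>
      · ext q
        simp only [mix]
        split_ifs <;> rfl)
  have h (p : BasisLabel S × BasisLabel S) : f p.1 * g p.2 = f (e p).1 * g (e p).1 := by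
    congr 1
    · exact hf fun q hq => (if_pos hq).symm
    · exact hg fun q hq => (if_neg hq).symm
  -- exchanging the bits outside `V` between two copies maps `f z * g z'` to `f z * g z`
  rw [Finset.sum_mul_sum, ← Fintype.sum_prod_type' (f := fun z z' => f z * g z'),
    Finset.sum_congr rfl fun p _ => h p, Equiv.sum_comp e (fun p => f p.1 * g p.1),
    Fintype.sum_prod_type' (f := fun z _ => f z * g z)]
  simp [Finset.mul_sum]

/-- The squared norm of the diagonal matrix with entries `v`. -/
noncomputable def weight (v : BasisLabel S → ℂ) : ℝ := ∑ z, Complex.normSq (v z)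

lemma weight_nonneg (v : BasisLabel S → ℂ) : 0 ≤ weight v :=
  Finset.sum_nonneg fun _ _ => Complex.normSq_nonneg _

lemma trace_scaleBy_of_isLocal {V D : Set (Fin S)} (hVD : Disjoint V D) {ρ : QState S}
    (hρ : IsLocal V ρ) {v : BasisLabel S → ℂ} (hv : DependsOn v D) :
    ρ.trace.re * weight v = 2 ^ S * (scaleBy v ρ).trace.re := by
  have h := sum_mul_of_dependsOn (f := fun z => ρ z z) (g := fun z => (Complex.normSq (v z) : ℂ))
    (V := V) (fun z z' h => hρ h h) (fun z z' h => by
      beta_reduce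
      rw [hv fun q hq => h q fun hqV => Set.disjoint_left.1 hVD hqV hq])
  have h1 : (∑ z, (Complex.normSq (v z) : ℂ)) = (weight v : ℂ) := by simp [weight]
  have h2 : (2 : ℂ) ^ S = ((2 ^ S : ℝ) : ℂ) := by push_cast; rfl
  have h3 : ∑ z, ρ z z * (Complex.normSq (v z) : ℂ) = (scaleBy v ρ).trace := by
    rw [trace_scaleBy]
    refine Finset.sum_congr rfl fun z _ => ?_
    rw [← Complex.mul_conj]
    change _ = v z * ρ z z * (starRingEnd ℂ) (v z)
    ring
  rw [h1, h2, h3] at h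
  have := congrArg Complex.re h
  rwa [Complex.re_mul_ofReal, Complex.re_ofReal_mul] at this

lemma scaleBy_hadamard (v : BasisLabel S → ℂ) (ρ σ : QState S) :
    scaleBy v ρ ⊙ σ = scaleBy v (ρ ⊙ σ) := by
  ext z w
  change v z * ρ z w * star (v w) * σ z w = v z * (ρ z w * σ z w) * star (v w)
  ring

lemma scaleBy_isLocal {V : Set (Fin S)} {v : BasisLabel S → ℂ} (hv : DependsOn v V) {ρ : QState S}
    (hρ : IsLocal V ρ) : IsLocal V (scaleBy v ρ) := by
  intro z z' w w' hz hw
  simp only [scaleBy, hρ hz hw, hv hz, hv hw]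

variable {X : Player → Type*}

/-- The tensor product of the parts of the two players, for the inputs `x`. -/
def prodState (M : ∀ P, X P → QState S) (x : ∀ P, X P) : QState S :=
  M .alice (x .alice) ⊙ M .bob (x .bob)

lemma prodState_eq (P : Player) (M : ∀ P, X P → QState S) (x : ∀ P, X P) :
    prodState M x = M P (x P) ⊙ M P.other (x P.other) := by
  cases P
  · rfl
  · exact hadamard_comm _ _

/-- The part of each player consists of positive operators on the qubits of this player, which
depend only on the input of this player and have traces at most `α P`. -/
structure IsProductFamily (own : Fin S → Player) (α : Player → ℝ)
    (M : ∀ P, X P → QState S) : Prop where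
  nonneg : ∀ P, 0 ≤ α P
  posSemidef : ∀ P x, (M P x).PosSemidef
  trace_le : ∀ P x, (M P x).trace.re ≤ α P
  isLocal : ∀ P x, IsLocal {q | own q = P} (M P x)

lemma ne_other (P : Player) : P ≠ P.other := by cases P <;> simp [Player.other]

lemma eq_or_eq_other (P Q : Player) : P = Q ∨ P = Q.other := by
  cases P <;> cases Q <;> simp [Player.other]

/-- The family after the map `T Q`, which may depend on the input of `Q`, is applied to the part of
player `Q`, and then the part of player `P` is conjugated by the diagonal matrix `v`. -/
def transfer (Q P : Player) (T : ∀ R, X R → QState S → QState S) (v : BasisLabel S → ℂ)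
    (M : ∀ P, X P → QState S) : ∀ P, X P → QState S :=
  fun R x => (if R = P then scaleBy v else id) ((if R = Q then T R x else id) (M R x))

lemma prodState_transfer (Q P : Player) (T : ∀ R, X R → QState S → QState S) (v : BasisLabel S → ℂ)
    (M : ∀ P, X P → QState S) (x : ∀ P, X P) :
    prodState (transfer Q P T v M) x =
      scaleBy v (T Q (x Q) (M Q (x Q)) ⊙ M Q.other (x Q.other)) := by
  rw [prodState_eq Q]
  rcases eq_or_eq_other P Q with rfl | rfl
  · simp [transfer, (ne_other P).symm, scaleBy_hadamard]
  · simp only [transfer, ne_other Q, (ne_other Q).symm, if_true, if_false, id]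
    rw [hadamard_comm, scaleBy_hadamard, hadamard_comm]

/-- Qubits of player `Q` become qubits of player `P`, in a state that depends on neither input. -/
lemma IsProductFamily.transfer {own own' : Fin S → Player} {α : Player → ℝ}
    {M : ∀ P, X P → QState S} (hM : IsProductFamily own α M) {D : Set (Fin S)} {Q P : Player}
    (hD : ∀ q ∈ D, own q = Q) {T : ∀ R, X R → QState S → QState S} {τ : ℝ} (hτ : 0 ≤ τ)
    (hpos : ∀ x ρ, ρ.PosSemidef → (T Q x ρ).PosSemidef)
    (htr : ∀ x ρ, ρ.PosSemidef → (T Q x ρ).trace.re ≤ τ * ρ.trace.re)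
    (hloc : ∀ x ρ, IsLocal {q | own q = Q} ρ → IsLocal ({q | own q = Q} \ D) (T Q x ρ))
    {v : BasisLabel S → ℂ} (hv : DependsOn v D)
    (hown : ∀ q ∈ D, own' q = P) (hown' : ∀ q, q ∉ D → own' q = own q) :
    IsProductFamily own'
      (fun R => (if R = P then weight v / 2 ^ S else 1) * ((if R = Q then τ else 1) * α R))
      (transfer Q P T v M) := by
  have hS : (0 : ℝ) < 2 ^ S := by positivity
  have hpos' (R x) : ((if R = Q then T R x else id) (M R x)).PosSemidef := by
    split_ifs with h
    · subst h; exact hpos _ _ (hM.posSemidef R x)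
    · exact hM.posSemidef R x
  have htr' (R x) : ((if R = Q then T R x else id) (M R x)).trace.re ≤
      (if R = Q then τ else 1) * α R := by
    split_ifs with h
    · subst h; exact (htr _ _ (hM.posSemidef R x)).trans
        (mul_le_mul_of_nonneg_left (hM.trace_le R x) hτ)
    · rw [one_mul]; exact hM.trace_le R x
  have hloc' (R x) : IsLocal ({q | own q = R} \ D) ((if R = Q then T R x else id) (M R x)) := by
    split_ifs with h
    · subst h; exact hloc _ _ (hM.isLocal R x)
    · refine (hM.isLocal R x).mono fun q hq => ⟨hq, fun hqD => h ?_⟩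
      rw [← hD q hqD]
      exact hq.symm
  have hsub (R) : {q | own q = R} \ D ⊆ {q | own' q = R} := fun q hq => by
    simpa [hown' q hq.2] using hq.1
  refine ⟨fun R => ?_, fun R x => ?_, fun R x => ?_, fun R x => ?_⟩
  · have := hM.nonneg R
    have := weight_nonneg v
    split_ifs <;> positivity
  · simp only [CommGate.transfer]
    by_cases h : R = P
    · simp only [if_pos h]
      exact scaleBy_posSemidef _ (hpos' R x)
    · simp only [if_neg h]
      exact hpos' R x
  · have h1 := htr' R x
    simp only [CommGate.transfer]
    by_cases h : R = P
    · simp only [if_pos h]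
      have h2 := trace_scaleBy_of_isLocal Set.disjoint_sdiff_left (hloc' R x) hv
      rw [div_mul_eq_mul_div, le_div_iff₀ hS, mul_comm _ ((2 : ℝ) ^ S), ← h2, mul_comm]
      exact mul_le_mul_of_nonneg_left h1 (weight_nonneg v)
    · simp only [if_neg h, one_mul]
      exact h1
  · simp only [CommGate.transfer]
    by_cases h : R = P
    · simp only [if_pos h]
      refine scaleBy_isLocal (fun z w hzw => hv fun q hq => hzw q ?_) ((hloc' R x).mono (hsub R))
      rw [h]; exact hown q hq
    · simp only [if_neg h]
      exact (hloc' R x).mono (hsub R)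

lemma transfer_bound (Q P : Player) (α : Player → ℝ) (τ κ : ℝ) :
    ((if Player.alice = P then κ else 1) * ((if Player.alice = Q then τ else 1) * α .alice)) *
      ((if Player.bob = P then κ else 1) * ((if Player.bob = Q then τ else 1) * α .bob)) =
      κ * τ * (α .alice * α .bob) := by
  cases P <;> cases Q <;> simp <;> ring

lemma two_mul_sum_bit (q : Fin S) (f : Bool → ℝ) :
    2 * ∑ z : BasisLabel S, f (z q) = 2 ^ S * (f false + f true) := by
  let e : Equiv.Perm (BasisLabel S) :=
    Function.Involutive.toPerm (fun z => Function.update z q (!z q)) (fun z => by simp)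
  have h : ∑ z : BasisLabel S, f (z q) = ∑ z : BasisLabel S, f (!z q) := by
    rw [← Equiv.sum_comp e]
    refine Finset.sum_congr rfl fun z _ => ?_
    change f (Function.update z q (!z q) q) = _
    rw [Function.update_self]
  rw [two_mul]
  nth_rw 2 [h]
  rw [← Finset.sum_add_distrib, Finset.sum_congr rfl fun z _ => show
    f (z q) + f (!z q) = f false + f true by cases z q <;> simp [add_comm],
    Finset.sum_const, nsmul_eq_mul]
  simp

lemma weight_bit (q : Fin S) (ψ : Bool → ℂ) :
    weight (fun z : BasisLabel S => ψ (z q)) =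
      2 ^ S * (Complex.normSq (ψ false) + Complex.normSq (ψ true)) / 2 := by
  have := two_mul_sum_bit q fun b => Complex.normSq (ψ b)
  rw [weight]
  linarith

lemma trace_partialTrace (q : Fin S) (ρ : QState S) :
    (partialTrace q ρ).trace.re = 2 * ρ.trace.re := by
  have h : IsLocal {q}ᶜ (partialTrace q ρ) := by
    intro z z' w w' hz hw
    refine Finset.sum_congr rfl fun b _ => ?_
    congr 1 <;>
    · ext r
      by_cases hr : r = q
      · subst hr; simp
      · simp [Function.update_of_ne hr, hz r hr, hw r hr]
  have h2 := trace_scaleBy_of_isLocal (D := {q}) (v := bitInd q false)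
    disjoint_compl_left h
    (fun z w hzw => by simp [bitInd, hzw q rfl])
  rw [show bitInd q false = fun z : BasisLabel S => if z q = false then (1 : ℂ) else 0 from rfl,
    weight_bit q fun b => if b = false then (1 : ℂ) else 0] at h2
  have h3 : (scaleBy (bitInd q false) (partialTrace q ρ)).trace = ρ.trace := by
    rw [trace_scaleBy]
    refine Eq.trans ?_ (sum_sum_update q fun z => ρ z z)
    refine Finset.sum_congr rfl fun z _ => ?_
    cases hz : z q <;> simp [bitInd, partialTrace, hz]
  rw [show (fun z : BasisLabel S => if z q = false then (1 : ℂ) else 0) = bitInd q false from rfl,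
    h3] at h2
  have hS : (0 : ℝ) < 2 ^ S := by positivity
  have h4 : (2 : ℝ) ^ S * (partialTrace q ρ).trace.re = 2 ^ S * (2 * ρ.trace.re) := by
    simp at h2
    linarith
  exact mul_left_cancel₀ hS.ne' h4

lemma partialTrace_isLocal (q : Fin S) {V : Set (Fin S)} {ρ : QState S} (h : IsLocal V ρ) :
    IsLocal (V \ {q}) (partialTrace q ρ) := by
  intro z z' w w' hz hw
  refine Finset.sum_congr rfl fun b _ => h (fun r hr => ?_) fun r hr => ?_ <;>
  · by_cases hrq : r = q
    · subst hrq; simp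
    · simp [hz r, hw r, hr, hrq]

/-- The operator `⟨φ|ρ|φ⟩` on the qubits other than `q`. -/
def bracket (q : Fin S) (φ : Bool → ℂ) (ρ : QState S) : QState S :=
  extend {q} (of fun _ c => star (φ (c ⟨q, by simp⟩))) * ρ *
    (extend {q} (of fun _ c => star (φ (c ⟨q, by simp⟩))))ᴴ

lemma bracket_apply (q : Fin S) (φ : Bool → ℂ) (ρ : QState S) (z w : BasisLabel S) :
    bracket q φ ρ z w = ∑ b : Bool, ∑ b' : Bool,
      star (φ b) * ρ (Function.update z q b) (Function.update w q b') * φ b' := by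
  let i : ({q} : Finset (Fin S)) := ⟨q, by simp⟩
  have : Unique ({q} : Finset (Fin S)) := ⟨⟨i⟩, fun r => Subtype.ext (Finset.mem_singleton.1 r.2)⟩
  let e : (({q} : Finset (Fin S)) → Bool) ≃ Bool :=
    ⟨fun c => c i, fun b _ => b, fun c => funext fun r => congrArg c (Subsingleton.elim _ _),
      fun _ => rfl⟩
  have ho (c : ({q} : Finset (Fin S)) → Bool) (z : BasisLabel S) :
      override {q} c z = Function.update z q (c i) := by
    ext r
    by_cases hr : r = q
    · subst hr; simp [override, i]
    · simp [override, hr]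
  rw [bracket, extend_conj_apply]
  simp only [ho, of_apply, star_star]
  rw [← Equiv.sum_comp e]
  refine Finset.sum_congr rfl fun c _ => ?_
  rw [← Equiv.sum_comp e]
  rfl

lemma bracket_posSemidef (q : Fin S) (φ : Bool → ℂ) {ρ : QState S} (h : ρ.PosSemidef) :
    (bracket q φ ρ).PosSemidef :=
  h.mul_mul_conjTranspose_same _

lemma bracket_isLocal (q : Fin S) (φ : Bool → ℂ) {V : Set (Fin S)} {ρ : QState S}
    (h : IsLocal V ρ) : IsLocal (V \ {q}) (bracket q φ ρ) := by
  intro z z' w w' hz hw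
  rw [bracket_apply, bracket_apply]
  refine Finset.sum_congr rfl fun b _ => Finset.sum_congr rfl fun b' _ => ?_
  rw [h (fun r hr => ?_) fun r hr => ?_] <;>
  · by_cases hrq : r = q
    · subst hrq; simp
    · simp [hz r, hw r, hr, hrq]

lemma trace_bracket_le (q : Fin S) (φ : Bool → ℂ) {ρ : QState S} (h : ρ.PosSemidef) :
    (bracket q φ ρ).trace.re ≤
      2 * (Complex.normSq (φ false) + Complex.normSq (φ true)) * ρ.trace.re := by
  -- the vector orthogonal to `φ` of the same norm completes `φ` to a multiple of a basis
  let φ' : Bool → ℂ := fun b => if b then star (φ false) else -star (φ true)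
  have hs : bracket q φ ρ + bracket q φ' ρ =
      ((Complex.normSq (φ false) + Complex.normSq (φ true) : ℝ) : ℂ) • partialTrace q ρ := by
    ext z w
    rw [Matrix.add_apply, Matrix.smul_apply, bracket_apply, bracket_apply]
    simp only [partialTrace, Fintype.sum_bool, φ', Complex.ofReal_add, ← Complex.mul_conj]
    simp
    ring
  have h2 := congrArg (fun A => (trace A).re) hs
  simp only [trace_add, trace_smul, Complex.add_re, smul_eq_mul, Complex.re_ofReal_mul,
    trace_partialTrace] at h2
  have := trace_re_nonneg (bracket_posSemidef q φ' h)
  linarith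

/-- Labels of the six terms into which an operator is split when a qubit is sent. -/
abbrev SplitIdx := (Bool × Bool) ⊕ Bool

/-- The vectors that a qubit to be sent is measured in: `(1, ±1)`, `(1, ±i)` and the standard
basis. -/
noncomputable def measVec : SplitIdx → Bool → ℂ
  | .inl (s, d), b => if b then (if d then 1 else -1) * (if s then Complex.I else 1) else 1
  | .inr d, b => if b = d then 1 else 0

/-- The vectors that are prepared in place of a qubit that is sent. -/
noncomputable def prepVec : SplitIdx → Bool → ℂ
  | .inl (s, d), b => measVec (.inl (s, d)) b
  | .inr d, b => if b = !d then 1 else 0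

/-- The coefficients with which the terms are combined. -/
noncomputable def splitCoeff : SplitIdx → ℂ
  | .inl _ => 1 / 4
  | .inr _ => -1

/-- The identity channel on a qubit as a signed combination of maps that measure the qubit and
prepare a new one. -/
lemma eq_sum_scaleBy_bracket (q : Fin S) (ρ : QState S) :
    ρ = ∑ j, splitCoeff j • scaleBy (fun z => prepVec j (z q)) (bracket q (measVec j) ρ) := by
  ext z w
  have h : ρ z w = ρ (Function.update z q (z q)) (Function.update w q (w q)) := by simp
  have h2 : ((∑ j, splitCoeff j • scaleBy (fun z => prepVec j (z q)) (bracket q (measVec j) ρ) :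
      QState S)) z w = ∑ j, splitCoeff j * (prepVec j (z q) * (∑ b : Bool, ∑ b' : Bool,
      star (measVec j b) * ρ (Function.update z q b) (Function.update w q b') * measVec j b') *
        star (prepVec j (w q))) := by
    rw [Matrix.sum_apply]
    refine Finset.sum_congr rfl fun j _ => ?_
    rw [← bracket_apply]
    rfl
  rw [h, h2]
  generalize hA : (fun b b' => ρ (Function.update z q b) (Function.update w q b')) = A
  have hA' (b b') : ρ (Function.update z q b) (Function.update w q b') = A b b' := by rw [← hA]
  simp only [hA', Fintype.sum_sum_type, Fintype.sum_prod_type, Fintype.sum_bool]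
  cases z q <;> cases w q <;> simp [splitCoeff, prepVec, measVec] <;> ring_nf <;>
    simp [Complex.I_sq] <;> ring

lemma norm_splitCoeff_mul (j : SplitIdx) :
    ‖splitCoeff j‖ * ((Complex.normSq (measVec j false) + Complex.normSq (measVec j true)) *
      (Complex.normSq (prepVec j false) + Complex.normSq (prepVec j true))) = 1 := by
  rcases j with ⟨s, d⟩ | d
  · cases s <;> cases d <;> simp [splitCoeff, measVec, prepVec] <;> norm_num
  · cases d <;> simp [splitCoeff, measVec, prepVec]

end ProductStates

end CommGate

/-! ### Correlation of circuits with functions of small bias -/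

namespace CommGate

section Bias

open Matrix
open scoped ComplexOrder

variable {S : ℕ} {Idx : Player → Type} {ω : Type} {L : ℕ} {X : Player → Type*}

/-- The action of an oracle gate on basis states uses and changes only the qubits it is applied
to. -/
lemma queryLabel_congr {ι : Type} (x : ι → Bool) {t : Fin S} {D : Finset (Fin S)}
    (addr : (D → Bool) → Option ι) {V : Set (Fin S)} (hD : ∀ q ∈ D, q ∈ V) (ht : t ∈ V)
    {z z' : BasisLabel S} (h : ∀ q ∈ V, z q = z' q) :
    ∀ q ∈ V, queryLabel x t D addr z q = queryLabel x t D addr z' q := by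
  intro q hq
  have : (fun q : D => z q) = fun q : D => z' q := funext fun q => h q (hD q q.2)
  by_cases hqt : q = t
  · subst hqt
    simp [queryLabel, this, h q ht]
  · simp [queryLabel, Function.update_of_ne hqt, h q hq]

lemma override_congr {D : Finset (Fin S)} (c : D → Bool) {V : Set (Fin S)}
    {z z' : BasisLabel S} (h : ∀ q ∈ V, z q = z' q) :
    ∀ q ∈ V, override D c z q = override D c z' q := by
  intro q hq
  simp [override, h q hq]

variable (x : ∀ P, Idx P → Bool) (o : ω → Fin L → Bool)

/-- Gates that a player performs on own qubits, without a change of owners. -/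
def IsInternal (P : Player) : CommGate S Idx ω L → Prop
  | unitary R _ _ => R = P
  | query R _ _ _ => R = P
  | measure R _ => R = P
  | _ => False

lemma IsInternal.newOwner {P : Player} {g : CommGate S Idx ω L} (h : g.IsInternal P)
    (own : Fin S → Player) : g.newOwner own = own := by
  cases g <;> first | rfl | exact h.elim

lemma IsInternal.isLocal_act {P : Player} {g : CommGate S Idx ω L} (h : g.IsInternal P)
    {own : Fin S → Player} (hg : g.Legal own) {ρ : QState S}
    (hρ : IsLocal {q | own q = P} ρ) : IsLocal {q | own q = P} (g.act x o ρ) := by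
  cases g with
  | unitary R D V =>
    obtain rfl : R = P := h
    intro z z' w w' hz hw
    simp only [act]
    rw [extend_conj_apply, extend_conj_apply]
    have hz' : (fun q : D => z q) = fun q : D => z' q := funext fun q => hz q (hg q q.2)
    have hw' : (fun q : D => w q) = fun q : D => w' q := funext fun q => hw q (hg q q.2)
    rw [hz', hw']
    refine Finset.sum_congr rfl fun c _ => Finset.sum_congr rfl fun c' _ => ?_
    rw [hρ (override_congr c hz) (override_congr c' hw)]
  | query R t D addr =>
    obtain rfl : R = P := h
    intro z z' w w' hz hw
    simp only [act]
    rw [queryMatrix_conj _ _ hg.2.1]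
    exact hρ (queryLabel_congr _ _ hg.2.2 hg.1 hz) (queryLabel_congr _ _ hg.2.2 hg.1 hw)
  | measure R q =>
    obtain rfl : R = P := h
    intro z z' w w' hz hw
    change (if z q = w q then ρ z w else 0) = if z' q = w' q then ρ z' w' else 0
    rw [hz q hg, hw q hg, hρ hz hw]
  | fresh _ _ => exact h.elim
  | send _ => exact h.elim
  | output _ _ _ => exact h.elim

lemma IsInternal.act_hadamard {P : Player} {g : CommGate S Idx ω L} (h : g.IsInternal P)
    {own : Fin S → Player} (hg : g.Legal own) (ρ : QState S) {σ : QState S}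
    (hσ : IsLocal {q | own q = P.other} σ) : g.act x o (ρ ⊙ σ) = g.act x o ρ ⊙ σ := by
  cases g with
  | unitary R D V =>
    obtain rfl : R = P := h
    ext z w
    simp only [act]
    rw [hadamard_apply, extend_conj_apply, extend_conj_apply, Finset.sum_mul]
    refine Finset.sum_congr rfl fun c _ => ?_
    rw [Finset.sum_mul]
    refine Finset.sum_congr rfl fun c' _ => ?_
    have ho (c : D → Bool) (z : BasisLabel S) :
        ∀ q ∈ {q | own q = R.other}, override D c z q = z q := fun q hq => by
      refine override_of_notMem _ _ fun hqD => ne_other R ?_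
      exact (hg q hqD).symm.trans hq
    rw [hadamard_apply, hσ (ho c z) (ho c' w)]
    ring
  | query R t D addr =>
    obtain rfl : R = P := h
    ext z w
    simp only [act]
    rw [queryMatrix_conj _ _ hg.2.1, queryMatrix_conj _ _ hg.2.1]
    have ho (z : BasisLabel S) :
        ∀ q ∈ {q | own q = R.other}, queryLabel (x R) t D addr z q = z q := fun q hq => by
      refine Function.update_of_ne (fun h => ne_other R ?_) _ _
      exact hg.1.symm.trans (h ▸ hq)
    rw [hadamard_apply, submatrix_apply, submatrix_apply, hadamard_apply, hσ (ho z) (ho w)]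
  | measure R q =>
    ext z w
    change (if z q = w q then ρ z w * σ z w else 0) = (if z q = w q then ρ z w else 0) * σ z w
    rw [ite_mul, zero_mul]
  | fresh _ _ => exact h.elim
  | send _ => exact h.elim
  | output _ _ _ => exact h.elim

lemma IsInternal.act_congr {P : Player} {g : CommGate S Idx ω L} (h : g.IsInternal P)
    {x x' : ∀ P, Idx P → Bool} (hx : x P = x' P) (ρ : QState S) :
    g.act x o ρ = g.act x' o ρ := by
  cases g with
  | unitary R D V => rfl
  | query R t D addr =>
    obtain rfl : R = P := h
    simp only [act, hx]
  | measure R q => rfl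
  | fresh _ _ => exact h.elim
  | send _ => exact h.elim
  | output _ _ _ => exact h.elim

/-- The operator `⟨c|ρ|c⟩` on the qubits outside the register `reg`. -/
noncomputable def regBracket (reg : Fin L ↪ Fin S) (c : Fin L → Bool) (ρ : QState S) : QState S :=
  ρ.submatrix (fun z => Function.extend reg c z) fun z => Function.extend reg c z

lemma extend_reg_congr (reg : Fin L ↪ Fin S) (c : Fin L → Bool) {V : Set (Fin S)}
    {z z' : BasisLabel S} (h : ∀ q ∈ V \ Set.range reg, z q = z' q) :
    ∀ q ∈ V, Function.extend reg c z q = Function.extend reg c z' q := by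
  intro q hq
  by_cases hr : ∃ b, reg b = q
  · obtain ⟨b, rfl⟩ := hr
    rw [reg.injective.extend_apply, reg.injective.extend_apply]
  · rw [Function.extend_apply' _ _ _ hr, Function.extend_apply' _ _ _ hr]
    exact h q ⟨hq, hr⟩

lemma regBracket_isLocal (reg : Fin L ↪ Fin S) (c : Fin L → Bool) {V : Set (Fin S)}
    {ρ : QState S} (h : IsLocal V ρ) : IsLocal (V \ Set.range reg) (regBracket reg c ρ) :=
  fun _ _ _ _ hz hw => h (extend_reg_congr reg c hz) (extend_reg_congr reg c hw)

lemma dependsOn_regInd (reg : Fin L ↪ Fin S) (c : Fin L → Bool) :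
    DependsOn (regInd reg c) (Set.range reg) := by
  intro z w h
  have : ∀ b, z (reg b) = w (reg b) := fun b => h _ ⟨b, rfl⟩
  simp [regInd, this]

lemma extend_reg_of_eq (reg : Fin L ↪ Fin S) {c : Fin L → Bool} {z : BasisLabel S}
    (h : ∀ b, z (reg b) = c b) : Function.extend reg c z = z := by
  ext q
  by_cases hr : ∃ b, reg b = q
  · obtain ⟨b, rfl⟩ := hr
    rw [reg.injective.extend_apply, h]
  · rw [Function.extend_apply' _ _ _ hr]

/-- On the event that the register has the value `c`, the part of the register can be handed over
to the other player. -/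
lemma scaleBy_regBracket (reg : Fin L ↪ Fin S) (c : Fin L → Bool) (ρ σ : QState S) :
    scaleBy (regInd reg c) (regBracket reg c ρ ⊙ σ) = scaleBy (regInd reg c) (ρ ⊙ σ) := by
  ext z w
  by_cases hz : ∀ b, z (reg b) = c b
  · by_cases hw : ∀ b, w (reg b) = c b
    · simp only [scaleBy, hadamard_apply, regBracket, submatrix_apply, extend_reg_of_eq reg hz,
        extend_reg_of_eq reg hw]
    · simp [scaleBy, regInd, hw]
  · simp [scaleBy, regInd, hz]

lemma weight_regInd_pos (reg : Fin L ↪ Fin S) (c : Fin L → Bool) : 0 < weight (regInd reg c) := by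
  refine Finset.sum_pos' (fun z _ => Complex.normSq_nonneg _)
    ⟨Function.extend reg c fun _ => false, Finset.mem_univ _, ?_⟩
  simp [regInd, reg.injective.extend_apply]

lemma trace_regBracket_le (reg : Fin L ↪ Fin S) (c : Fin L → Bool) {ρ : QState S}
    (h : ρ.PosSemidef) :
    (regBracket reg c ρ).trace.re ≤ 2 ^ S / weight (regInd reg c) * ρ.trace.re := by
  have h1 := trace_scaleBy_of_isLocal (V := Set.univ \ Set.range reg) Set.disjoint_sdiff_left
    (regBracket_isLocal reg c (V := Set.univ) (ρ := ρ)
      fun z z' w w' hz hw => by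
        rw [funext fun q => hz q trivial, funext fun q => hw q trivial])
    (dependsOn_regInd reg c)
  have h2 : (scaleBy (regInd reg c) (regBracket reg c ρ)).trace.re ≤ ρ.trace.re := by
    simp only [trace, Complex.re_sum, diag_apply]
    refine Finset.sum_le_sum fun z _ => ?_
    by_cases hz : ∀ b, z (reg b) = c b
    · simp [scaleBy, regInd, hz, regBracket, extend_reg_of_eq reg hz]
    · simpa [scaleBy, regInd, hz] using diag_re_nonneg h z
  rw [div_mul_eq_mul_div, le_div_iff₀ (weight_regInd_pos reg c), h1]
  exact mul_le_mul_of_nonneg_left h2 (by positivity)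

lemma partialTrace_hadamard (q : Fin S) (ρ : QState S) {V : Set (Fin S)} (hq : q ∉ V)
    {σ : QState S} (hσ : IsLocal V σ) : partialTrace q (ρ ⊙ σ) = partialTrace q ρ ⊙ σ := by
  ext z w
  simp only [partialTrace, hadamard_apply, Finset.sum_mul]
  refine Finset.sum_congr rfl fun b _ => ?_
  have (z : BasisLabel S) : ∀ r ∈ V, Function.update z q b r = z r := fun r hr =>
    Function.update_of_ne (fun h : r = q => hq (h ▸ hr)) _ _
  rw [hσ (this z) (this w)]

lemma scaleBy_one (ρ : QState S) : scaleBy (fun _ => 1) ρ = ρ := by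
  ext z w
  simp [scaleBy]

lemma weight_one : weight (fun _ : BasisLabel S => 1) = 2 ^ S := by
  simp [weight]

/-- All gates but the sending of a qubit map product states to product states. -/
lemma IsProductFamily.exists_act {own : Fin S → Player} {α : Player → ℝ}
    {M : ∀ P, X P → QState S} (hM : IsProductFamily own α M) {g : CommGate S Idx ω L}
    (hg : g.Legal own) (hsend : ∀ q, g ≠ send q) (enc : ∀ P, X P → Idx P → Bool) :
    ∃ (α' : Player → ℝ) (M' : ∀ P, X P → QState S), IsProductFamily (g.newOwner own) α' M' ∧
      α' .alice * α' .bob = α .alice * α .bob ∧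
      ∀ x, g.act (fun P => enc P (x P)) o (prodState M x) = prodState M' x := by
  have hS : (0 : ℝ) < 2 ^ S := by positivity
  have internal (P : Player) (h : g.IsInternal P) : ∃ (α' : Player → ℝ)
      (M' : ∀ P, X P → QState S), IsProductFamily (g.newOwner own) α' M' ∧
      α' .alice * α' .bob = α .alice * α .bob ∧
      ∀ x, g.act (fun P => enc P (x P)) o (prodState M x) = prodState M' x := by
    let y : ∀ R, X R → ∀ P, Idx P → Bool := fun R x =>
      Function.update (fun _ _ => false) R (enc R x)
    refine ⟨_, _, hM.transfer (D := ∅) (own' := g.newOwner own) (Q := P) (P := P) (by simp)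
      (T := fun R x => g.act (y R x) o) (τ := 1) zero_le_one (v := fun _ => 1)
      (fun x ρ hρ => act_posSemidef _ _ _ hρ)
      (fun x ρ hρ => by rw [one_mul]; exact trace_act_le _ _ hg hρ)
      (fun x ρ hρ => by rw [Set.sdiff_empty]; exact h.isLocal_act _ _ hg hρ)
      (fun _ _ _ => rfl) (by simp) (fun q _ => by rw [h.newOwner]), ?_, fun x => ?_⟩
    · rw [transfer_bound, weight_one, div_self hS.ne']
      ring
    · rw [prodState_transfer, scaleBy_one, prodState_eq P,
        h.act_hadamard _ _ hg _ (hM.isLocal _ _), h.act_congr (x' := y P (x P))]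
      simp [y]
  cases g with
  | unitary P D V => exact internal P rfl
  | query P t D addr => exact internal P rfl
  | measure P q => exact internal P rfl
  | send q => exact absurd rfl (hsend q)
  | fresh P q =>
    refine ⟨_, _, hM.transfer (D := {q}) (own' := (fresh P q : CommGate S Idx ω L).newOwner own)
      (Q := own q) (P := P) (by simp) (T := fun _ _ => partialTrace q) zero_le_two
      (v := bitInd q false)
      (fun x ρ hρ => partialTrace_posSemidef q hρ) (fun x ρ _ => (trace_partialTrace q ρ).le)
      (fun x ρ hρ => partialTrace_isLocal q hρ) (fun z w h => by simp [bitInd, h q rfl])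
      (by simp [newOwner]) (fun r hr => Function.update_of_ne (by simpa using hr) _ _),
      ?_, fun x => ?_⟩
    · have := weight_bit q fun b => if b = false then (1 : ℂ) else 0
      rw [transfer_bound, show bitInd q false =
        fun z : BasisLabel S => if z q = false then (1 : ℂ) else 0 from rfl, this]
      simp
      field_simp
    · rw [prodState_transfer, act_fresh, prodState_eq (own q),
        partialTrace_hadamard q _ (V := {r | own r = (own q).other}) (ne_other _)
          (hM.isLocal _ _)]
  | output P reg k =>
    have hw := weight_regInd_pos reg (o k)
    refine ⟨_, _, hM.transfer (D := Set.range reg)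
      (own' := (output P reg k : CommGate S Idx ω L).newOwner own)
      (Q := P) (P := P.other) (by rintro _ ⟨b, rfl⟩; exact hg b)
      (T := fun _ _ => regBracket reg (o k)) (τ := 2 ^ S / weight (regInd reg (o k)))
      (by positivity) (v := regInd reg (o k))
      (fun x ρ hρ => hρ.submatrix _) (fun x ρ hρ => trace_regBracket_le reg (o k) hρ)
      (fun x ρ hρ => regBracket_isLocal reg (o k) hρ) (dependsOn_regInd reg (o k))
      (fun q hq => if_pos hq) (fun q hq => if_neg hq), ?_, fun x => ?_⟩
    · rw [transfer_bound]
      field_simp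
    · rw [prodState_transfer, act_output, scaleBy_regBracket, ← prodState_eq]

lemma bracket_hadamard (q : Fin S) (φ : Bool → ℂ) (ρ : QState S) {V : Set (Fin S)} (hq : q ∉ V)
    {σ : QState S} (hσ : IsLocal V σ) : bracket q φ (ρ ⊙ σ) = bracket q φ ρ ⊙ σ := by
  ext z w
  simp only [bracket_apply, hadamard_apply, Finset.sum_mul]
  refine Finset.sum_congr rfl fun b _ => Finset.sum_congr rfl fun b' _ => ?_
  have (z : BasisLabel S) (b : Bool) : ∀ r ∈ V, Function.update z q b r = z r := fun r hr =>
    Function.update_of_ne (fun h : r = q => hq (h ▸ hr)) _ _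
  rw [hσ (this z b) (this w b')]
  ring

/-- If a qubit is sent, then a product state becomes a combination of six product states. -/
lemma IsProductFamily.exists_send {own : Fin S → Player} {α : Player → ℝ}
    {M : ∀ P, X P → QState S} (hM : IsProductFamily own α M) (q : Fin S) :
    ∃ (α' : SplitIdx → Player → ℝ) (M' : SplitIdx → ∀ P, X P → QState S),
      (∀ j, IsProductFamily ((send q : CommGate S Idx ω L).newOwner own) (α' j) (M' j)) ∧
      (∀ j, ‖splitCoeff j‖ * (α' j .alice * α' j .bob) = α .alice * α .bob) ∧
      ∀ x, prodState M x = ∑ j, splitCoeff j • prodState (M' j) x := by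
  have hS : (0 : ℝ) < 2 ^ S := by positivity
  refine ⟨_, _, fun j => hM.transfer (D := {q})
    (own' := (send q : CommGate S Idx ω L).newOwner own)
    (Q := own q) (P := (own q).other) (by simp) (T := fun _ _ => bracket q (measVec j))
    (τ := 2 * (Complex.normSq (measVec j false) + Complex.normSq (measVec j true)))
    (mul_nonneg zero_le_two (add_nonneg (Complex.normSq_nonneg _) (Complex.normSq_nonneg _)))
    (v := fun z => prepVec j (z q))
    (fun x ρ hρ => bracket_posSemidef q _ hρ) (fun x ρ hρ => trace_bracket_le q _ hρ)
    (fun x ρ hρ => bracket_isLocal q _ hρ) (fun z w h => by beta_reduce; rw [h q rfl])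
    (by simp [newOwner]) (fun r hr => Function.update_of_ne (by simpa using hr) _ _),
    fun j => ?_, fun x => ?_⟩
  · rw [transfer_bound, weight_bit]
    have := norm_splitCoeff_mul j
    calc _ = ‖splitCoeff j‖ * ((Complex.normSq (measVec j false) +
          Complex.normSq (measVec j true)) * (Complex.normSq (prepVec j false) +
          Complex.normSq (prepVec j true))) * (α .alice * α .bob) := by field_simp
      _ = _ := by rw [this, one_mul]
  · simp only [prodState_transfer]
    conv_lhs => rw [eq_sum_scaleBy_bracket q (prodState M x)]
    refine Finset.sum_congr rfl fun j _ => ?_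
    rw [prodState_eq (own q), bracket_hadamard q _ _ (V := {r | own r = (own q).other})
      (ne_other _) (hM.isLocal _ _)]

/-- The identity operator is a product state. -/
lemma exists_prodState_eq_one (own : Fin S → Player) :
    ∃ M : ∀ P, X P → QState S, IsProductFamily own (fun _ => 2 ^ S) M ∧
      ∀ x, prodState M x = 1 := by
  classical
  let r (P : Player) (z : BasisLabel S) : BasisLabel S := fun q => if own q = P then z q else false
  have hr {P : Player} {z w : BasisLabel S} :
      r P z = r P w ↔ ∀ q ∈ {q | own q = P}, z q = w q := by
    constructor
    · intro h q hq
      have := congrFun h q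
      simp only [Set.mem_ofPred_eq] at hq
      simpa [r, hq] using this
    · intro h
      ext q
      by_cases hq : own q = P
      · simp [r, hq, h q hq]
      · simp [r, hq]
  refine ⟨fun P _ => (1 : QState S).submatrix (r P) (r P), ⟨fun P => by positivity,
    fun P x => PosSemidef.one.submatrix _, fun P x => ?_, fun P x z z' w w' hz hw => ?_⟩,
    fun x => ?_⟩
  · simp only [trace, diag_apply, submatrix_apply, one_apply_eq]
    simp [← Complex.ofReal_ofNat, ← Complex.ofReal_pow]
  · rw [submatrix_apply, submatrix_apply, hr.2 hz, hr.2 hw]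
  · ext z w
    simp only [prodState, hadamard_apply, submatrix_apply, one_apply]
    by_cases h : z = w
    · simp [h]
    · have : ¬ (r .alice z = r .alice w ∧ r .bob z = r .bob w) := by
        rintro ⟨h1, h2⟩
        refine h (funext fun q => ?_)
        cases hq : own q
        · exact hr.1 h1 q hq
        · exact hr.1 h2 q hq
      rw [if_neg h]
      by_cases h1 : r .alice z = r .alice w
      · rw [if_neg fun h2 => this ⟨h1, h2⟩, mul_zero]
      · rw [if_neg h1, zero_mul]

instance : Fintype Player := ⟨{.alice, .bob}, fun P => by cases P <;> simp⟩

variable [∀ P, Fintype (X P)]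

/-- A function `χ` of the two inputs has bias at most `Δ` if its correlation with products of
bounded functions of the single inputs is at most `Δ`. -/
def BiasAtMost (χ : (∀ P, X P) → ℂ) (Δ : ℝ) : Prop :=
  ∀ (a : ∀ P, X P → ℝ) (α : Player → ℝ), (∀ P x, 0 ≤ a P x) → (∀ P x, a P x ≤ α P) →
    ‖∑ x, χ x * ((a .alice (x .alice) * a .bob (x .bob) : ℝ) : ℂ)‖ ≤ Δ * (α .alice * α .bob)

/-- Circuits with little communication are hardly correlated with functions of small bias. -/
theorem norm_sum_trace_run_le {χ : (∀ P, X P) → ℂ} {Δ : ℝ} (hΔ : 0 ≤ Δ) (hχ : BiasAtMost χ Δ)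
    (enc : ∀ P, X P → Idx P → Bool) (gs : List (CommGate S Idx ω L)) {own : Fin S → Player}
    (hg : LegalFrom own gs) {α : Player → ℝ} {M : ∀ P, X P → QState S}
    (hM : IsProductFamily own α M) :
    ‖∑ x, χ x * (run (fun P => enc P (x P)) o gs (prodState M x)).trace‖ ≤
      8 ^ (gs.map cost).sum * (Δ * (α .alice * α .bob)) / 2 ^ S := by
  have hS : (0 : ℝ) < 2 ^ S := by positivity
  induction gs generalizing own α M with
  | nil =>
    have h (x : ∀ P, X P) : (2 : ℂ) ^ S * (prodState M x).trace =
        (((M .alice (x .alice)).trace.re * (M .bob (x .bob)).trace.re : ℝ) : ℂ) := by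
      have := sum_mul_of_dependsOn (f := fun z => M .alice (x .alice) z z)
        (g := fun z => M .bob (x .bob) z z) (V := {q | own q = .alice})
        (fun z w h => hM.isLocal .alice _ h h) (fun z w h => by
          have h' : ∀ q ∈ {q | own q = Player.bob}, z q = w q := fun q hq => h q (by
            simp only [Set.mem_ofPred_eq] at hq
            simp [hq])
          exact hM.isLocal .bob _ h' h')
      rw [Complex.ofReal_mul, ← trace_eq_re (hM.posSemidef _ _), ← trace_eq_re (hM.posSemidef _ _)]
      exact this.symm
    have h2 : ∑ x, χ x * (prodState M x).trace = (∑ x, χ x * (((M .alice (x .alice)).trace.re *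
        (M .bob (x .bob)).trace.re : ℝ) : ℂ)) / 2 ^ S := by
      rw [Finset.sum_div]
      refine Finset.sum_congr rfl fun x _ => ?_
      rw [← h]
      have : (2 : ℂ) ^ S ≠ 0 := by positivity
      field_simp
    simp only [run_nil, List.map_nil, List.sum_nil, pow_zero, one_mul]
    rw [h2, norm_div, norm_pow, Complex.norm_ofNat]
    gcongr
    exact hχ (fun P x => (M P x).trace.re) α (fun P x => trace_re_nonneg (hM.posSemidef P x))
      hM.trace_le
  | cons g gs ih =>
    simp only [run_cons, List.map_cons, List.sum_cons]
    have hα := mul_nonneg hΔ (mul_nonneg (hM.nonneg .alice) (hM.nonneg .bob))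
    by_cases hsend : ∀ q, g ≠ send q
    · obtain ⟨α', M', hM', hα', hact⟩ := hM.exists_act o hg.1 hsend enc
      simp only [hact]
      refine (ih hg.2 hM').trans ?_
      rw [hα']
      gcongr
      · norm_num
      · omega
    · push Not at hsend
      obtain ⟨q, rfl⟩ := hsend
      obtain ⟨α', M', hM', hα', hsum⟩ := hM.exists_send (Idx := Idx) (ω := ω) (L := L) q
      have h1 : ∑ x, χ x * (run (fun P => enc P (x P)) o gs (prodState M x)).trace =
          ∑ j, splitCoeff j *
            ∑ x, χ x * (run (fun P => enc P (x P)) o gs (prodState (M' j) x)).trace := by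
        simp only [Finset.mul_sum]
        rw [Finset.sum_comm]
        refine Finset.sum_congr rfl fun x _ => ?_
        rw [hsum, map_sum, trace_sum, Finset.mul_sum]
        refine Finset.sum_congr rfl fun j _ => ?_
        rw [map_smul, trace_smul, smul_eq_mul]
        ring
      simp only [act]
      rw [h1]
      calc _ ≤ ∑ j, ‖splitCoeff j *
            ∑ x, χ x * (run (fun P => enc P (x P)) o gs (prodState (M' j) x)).trace‖ :=
            norm_sum_le _ _
        _ ≤ ∑ j : SplitIdx, 8 ^ (gs.map cost).sum * (Δ * (α .alice * α .bob)) / 2 ^ S := by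
            refine Finset.sum_le_sum fun j _ => ?_
            rw [norm_mul]
            refine (mul_le_mul_of_nonneg_left (ih hg.2 (hM' j)) (norm_nonneg _)).trans_eq ?_
            rw [← hα' j]
            ring
        _ = 6 * (8 ^ (gs.map cost).sum * (Δ * (α .alice * α .bob)) / 2 ^ S) := by
            rw [Finset.sum_const, nsmul_eq_mul, Finset.card_univ]
            norm_num [Fintype.card_sum]
        _ ≤ 8 * (8 ^ (gs.map cost).sum * (Δ * (α .alice * α .bob)) / 2 ^ S) := by
            gcongr
            norm_num
        _ = _ := by
            simp only [cost, pow_add, pow_one]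
            ring

end Bias

end CommGate

/-! ### Success probability of a segment with little communication -/

namespace CommGate

section Segment

open Matrix
open scoped ComplexOrder

variable {S : ℕ} {Idx : Player → Type} {ω : Type} {L : ℕ}

/-- The labels of the outputs that are produced by a list of gates. -/
abbrev outputLabels (gs : List (CommGate S Idx ω L)) : List ω := gs.filterMap outputLabel

lemma act_congr_outcome (x : ∀ P, Idx P → Bool) {o o' : ω → Fin L → Bool}
    {g : CommGate S Idx ω L} (h : ∀ k, g.outputLabel = some k → o k = o' k) (ρ : QState S) :
    g.act x o ρ = g.act x o' ρ := by
  cases g with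
  | output P reg k => simp only [act_output, h k rfl]
  | _ => rfl

lemma run_congr_outcome (x : ∀ P, Idx P → Bool) {o o' : ω → Fin L → Bool}
    {gs : List (CommGate S Idx ω L)} (h : ∀ k ∈ outputLabels gs, o k = o' k) (ρ : QState S) :
    run x o gs ρ = run x o' gs ρ := by
  induction gs generalizing ρ with
  | nil => rfl
  | cons g gs ih =>
    rw [run_cons, run_cons, act_congr_outcome x (o' := o') fun k hk => h k ?_, ih]
    · intro k hk
      refine h k ?_
      simp only [outputLabels, List.mem_filterMap, List.mem_cons] at hk ⊢
      obtain ⟨g', hg', hk⟩ := hk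
      exact ⟨g', .inr hg', hk⟩
    · simp only [outputLabels, List.mem_filterMap, List.mem_cons]
      exact ⟨g, .inl rfl, hk⟩

variable {F : Type*} [Fintype F] [Fintype ω] [DecidableEq ω]

/-- The functions that vanish outside `T`. -/
def supportedOn (F : Type*) [Fintype F] [Zero F] (T : Finset ω) : Finset (ω → F) :=
  Fintype.piFinset fun k => if k ∈ T then Finset.univ else {0}

lemma mem_supportedOn [Zero F] {T : Finset ω} {f : ω → F} :
    f ∈ supportedOn F T ↔ ∀ k, k ∉ T → f k = 0 := by
  rw [supportedOn, Fintype.mem_piFinset]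
  refine forall_congr' fun k => ?_
  split_ifs with h <;> simp [h]

lemma card_supportedOn [Zero F] (T : Finset ω) :
    (supportedOn F T).card = Fintype.card F ^ T.card := by
  rw [supportedOn, Fintype.card_piFinset, ← Finset.prod_subset (Finset.subset_univ T)]
  · rw [Finset.prod_congr rfl fun k hk => by rw [if_pos hk], Finset.prod_const, Finset.card_univ]
  · intro k _ hk
    rw [if_neg hk, Finset.card_singleton]

lemma sum_supportedOn_insert [Zero F] {T : Finset ω} {k : ω} (hk : k ∉ T) (h : (ω → F) → ℝ) :
    ∑ o ∈ supportedOn F (insert k T), h o =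
      ∑ v, ∑ o ∈ supportedOn F T, h (Function.update o k v) := by
  rw [← Finset.sum_product']
  symm
  refine Finset.sum_nbij' (fun p => Function.update p.2 k p.1)
    (fun o => (o k, Function.update o k 0)) ?_ ?_ ?_ ?_ (fun _ _ => rfl)
  · rintro ⟨v, o⟩ ho
    simp only [Finset.mem_product, mem_supportedOn] at ho ⊢
    intro j hj
    rw [Finset.mem_insert, not_or] at hj
    rw [Function.update_of_ne hj.1]
    exact ho.2 j hj.2
  · intro o ho
    simp only [Finset.mem_product, mem_supportedOn, Finset.mem_univ, true_and] at ho ⊢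
    intro j hj
    by_cases hjk : j = k
    · subst hjk; simp
    · rw [Function.update_of_ne hjk]
      exact ho j (by simp [hjk, hj])
  · rintro ⟨v, o⟩ ho
    simp only [Finset.mem_product, mem_supportedOn] at ho
    simp [← ho.2 k hk]
  · intro o _
    simp

/-- The probabilities of all outcomes add up to at most `1`. -/
lemma sum_trace_run_le [Zero F] (x : ∀ P, Idx P → Bool) (e : F ↪ (Fin L → Bool))
    {own : Fin S → Player} {gs : List (CommGate S Idx ω L)} (hg : LegalFrom own gs)
    (hnd : (outputLabels gs).Nodup) {ρ : QState S} (hρ : ρ.PosSemidef) :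
    ∑ o ∈ supportedOn F (outputLabels gs).toFinset,
      (run x (fun k => e (o k)) gs ρ).trace.re ≤ ρ.trace.re := by
  induction gs generalizing own ρ with
  | nil =>
    have h1 : ∀ o ∈ supportedOn F (outputLabels ([] : List (CommGate S Idx ω L))).toFinset,
        (run x (fun k => e (o k)) [] ρ).trace.re = ρ.trace.re := fun _ _ => rfl
    rw [Finset.sum_congr rfl h1, Finset.sum_const, card_supportedOn]
    simp
  | cons g gs ih =>
    have key (h : g.outputLabel = none) : ∑ o ∈ supportedOn F (outputLabels (g :: gs)).toFinset,
        (run x (fun k => e (o k)) (g :: gs) ρ).trace.re ≤ ρ.trace.re := by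
      have hl : outputLabels (g :: gs) = outputLabels gs := List.filterMap_cons_none h
      rw [hl] at hnd ⊢
      have ha (o : ω → F) :
          g.act x (fun k => e (o k)) ρ = g.act x (fun _ _ => false) ρ :=
        act_congr_outcome x (fun k hk => by simp [h] at hk) ρ
      simp only [run_cons, ha]
      exact (ih hg.2 hnd (act_posSemidef _ _ _ hρ)).trans (trace_act_le _ _ hg.1 hρ)
    cases g with
    | unitary P D V => exact key rfl
    | query P t D addr => exact key rfl
    | measure P q => exact key rfl
    | send q => exact key rfl
    | fresh P q => exact key rfl
    | output P reg k =>
      have hl : outputLabels (output P reg k :: gs) = k :: outputLabels gs :=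
        List.filterMap_cons_some rfl
      rw [hl] at hnd ⊢
      rw [List.toFinset_cons, sum_supportedOn_insert (by simpa using (List.nodup_cons.1 hnd).1)]
      have hr (o : ω → F) (v : F) :
          run x (fun k' => e (Function.update o k v k')) (output P reg k :: gs) ρ =
            run x (fun k' => e (o k')) gs (scaleBy (regInd reg (e v)) ρ) := by
        rw [run_cons, act_output, Function.update_self]
        refine run_congr_outcome x (fun j hj => ?_) _
        rw [Function.update_of_ne]
        rintro rfl
        exact (List.nodup_cons.1 hnd).1 hj
      simp only [hr]
      calc _ ≤ ∑ v : F, (scaleBy (regInd reg (e v)) ρ).trace.re :=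
            Finset.sum_le_sum fun v _ =>
              ih hg.2 (List.nodup_cons.1 hnd).2 (scaleBy_posSemidef _ hρ)
        _ = ∑ z, ∑ v : F, (scaleBy (regInd reg (e v)) ρ z z).re := by
            simp only [trace, Complex.re_sum, diag_apply]
            exact Finset.sum_comm
        _ ≤ ∑ z, (ρ z z).re := by
            refine Finset.sum_le_sum fun z _ => ?_
            by_cases hz : ∃ v, ∀ b, z (reg b) = e v b
            · obtain ⟨v, hv⟩ := hz
              rw [Finset.sum_eq_single v]
              · simp [scaleBy, regInd, hv]
              · intro w _ hw
                have : ¬ ∀ b, z (reg b) = e w b := fun h =>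
                  hw (e.injective (funext fun b => (h b).symm.trans (hv b)))
                simp [scaleBy, regInd, this]
              · simp
            · push Not at hz
              refine le_of_eq_of_le (Finset.sum_eq_zero fun v _ => ?_) (diag_re_nonneg hρ z)
              obtain ⟨b, hb⟩ := hz v
              have : ¬ ∀ b, z (reg b) = e v b := fun h => hb (h b)
              simp [scaleBy, regInd, this]
        _ = _ := by simp [trace]

lemma addChar_sum {G ι : Type*} [AddCommMonoid G] (ψ : AddChar G ℂ) (s : Finset ι) (f : ι → G) :
    ψ (∑ i ∈ s, f i) = ∏ i ∈ s, ψ (f i) := by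
  classical
  induction s using Finset.induction_on with
  | empty => simp
  | insert a s ha ih => rw [Finset.sum_insert ha, Finset.prod_insert ha, ψ.map_add_eq_mul, ih]

/-- The indicator of the functions that vanish on `T`, in terms of characters. -/
lemma sum_supportedOn_addChar [Field F] [DecidableEq F] {ψ : AddChar F ℂ} (hψ : ψ.IsPrimitive)
    (T : Finset ω) (d : ω → F) :
    ∑ c ∈ supportedOn F T, ψ (∑ k, c k * d k) =
      if ∀ k ∈ T, d k = 0 then (Fintype.card F : ℂ) ^ T.card else 0 := by
  have h1 (c : ω → F) : ψ (∑ k, c k * d k) = ∏ k, ψ (c k * d k) :=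
    addChar_sum ψ _ _
  simp only [h1]
  rw [supportedOn, ← Finset.prod_univ_sum (fun k : ω => if k ∈ T then Finset.univ else {(0 : F)})
    (fun k v => ψ (v * d k)), ← Finset.prod_subset (Finset.subset_univ T)]
  · have h2 : ∀ k ∈ T, ∑ v ∈ (if k ∈ T then Finset.univ else {0}), ψ (v * d k) =
        if d k = 0 then (Fintype.card F : ℂ) else 0 := fun k hk => by
      rw [if_pos hk, AddChar.sum_mulShift _ hψ]
      split_ifs <;> simp
    rw [Finset.prod_congr rfl h2]
    split_ifs with h
    · rw [Finset.prod_congr rfl fun k hk => if_pos (h k hk), Finset.prod_const]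
    · push Not at h
      obtain ⟨k, hk, hd⟩ := h
      exact Finset.prod_eq_zero hk (if_neg hd)
  · intro k _ hk
    simp [hk]

variable {X : Player → Type*} [∀ P, Fintype (X P)] [∀ P, Nonempty (X P)]

/-- A segment that produces the outputs `f x` with probability at least `p` on all inputs `x`,
where all nontrivial characters of the outputs have small bias, needs much communication. -/
theorem le_of_forall_le_trace_run [Field F] {ψ : AddChar F ℂ} (hψ : ψ.IsPrimitive)
    (e : F ↪ (Fin L → Bool)) (enc : ∀ P, X P → Idx P → Bool) (f : (∀ P, X P) → ω → F)
    {own : Fin S → Player} {gs : List (CommGate S Idx ω L)} (hg : LegalFrom own gs)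
    (hnd : (outputLabels gs).Nodup) {p θ : ℝ} (hθ : 0 ≤ θ)
    (hp : ∀ x, p ≤ (run (fun P => enc P (x P)) (fun k => e (f x k)) gs 1).trace.re)
    (hbias : ∀ c ∈ supportedOn F (outputLabels gs).toFinset, c ≠ 0 →
      BiasAtMost (fun x => ψ (∑ k, c k * f x k)) (Fintype.card (∀ P, X P) * θ)) :
    p ≤ 2 ^ S * (1 / (Fintype.card F : ℝ) ^ (outputLabels gs).length +
      (Fintype.card F : ℝ) ^ (outputLabels gs).length * 8 ^ (gs.map cost).sum * θ) := by
  classical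
  set T := (outputLabels gs).toFinset with hT
  have hcard : (outputLabels gs).length = T.card := (List.toFinset_card_of_nodup hnd).symm
  rw [hcard]
  set k := T.card
  set q := (gs.map cost).sum
  set N : ℝ := (Fintype.card F : ℝ) with hN
  set A : ℝ := (Fintype.card (∀ P, X P) : ℝ) with hA
  have hNpos : 0 < N := by rw [hN]; exact_mod_cast Fintype.card_pos
  have hApos : 0 < A := by rw [hA]; exact_mod_cast Fintype.card_pos
  let G (o : ω → F) (x : ∀ P, X P) : ℂ :=
    (run (fun P => enc P (x P)) (fun k => e (o k)) gs 1).trace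
  have hG (o x) : G o x = ((G o x).re : ℂ) := trace_eq_re (run_posSemidef _ _ _ PosSemidef.one)
  have h1 (x : ∀ P, X P) : (N : ℂ) ^ k * G (f x) x =
      ∑ o ∈ supportedOn F T, ∑ c ∈ supportedOn F T,
        ψ (∑ k, c k * (f x k - o k)) * G o x := by
    simp only [← Finset.sum_mul, sum_supportedOn_addChar hψ]
    let o : ω → F := fun k => if k ∈ T then f x k else 0
    have ho : o ∈ supportedOn F T := mem_supportedOn.2 fun k hk => if_neg hk
    rw [Finset.sum_eq_single o]
    · have : G (f x) x = G o x := by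
        refine congrArg trace (run_congr_outcome _ (fun k hk => ?_) _)
        have : k ∈ T := List.mem_toFinset.2 hk
        simp [o, this]
      rw [if_pos (fun k hk => by simp [o, hk]), this, hN]
      simp [k]
    · intro o' ho' hne
      rw [if_neg, zero_mul]
      intro h
      refine hne (funext fun j => ?_)
      by_cases hj : j ∈ T
      · simp [o, hj, (sub_eq_zero.1 (h j hj))]
      · simp [o, hj, mem_supportedOn.1 ho' j hj]
    · exact fun h => absurd ho h
  have h2 : (N : ℂ) ^ k * ∑ x, G (f x) x = ∑ c ∈ supportedOn F T, ∑ o ∈ supportedOn F T,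
      ψ (-∑ k, c k * o k) * ∑ x, ψ (∑ k, c k * f x k) * G o x := by
    rw [Finset.mul_sum, Finset.sum_congr rfl fun x _ => h1 x, Finset.sum_comm]
    rw [Finset.sum_congr rfl fun o _ => Finset.sum_comm, Finset.sum_comm]
    refine Finset.sum_congr rfl fun c _ => Finset.sum_congr rfl fun o _ => ?_
    rw [Finset.mul_sum]
    refine Finset.sum_congr rfl fun x _ => ?_
    rw [← mul_assoc, ← AddChar.map_add_eq_mul]
    congr 2
    simp only [mul_sub, Finset.sum_sub_distrib]
    ring
  have hzero : ‖∑ o ∈ supportedOn F T, ψ (-∑ k, (0 : ω → F) k * o k) *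
      ∑ x, ψ (∑ k, (0 : ω → F) k * f x k) * G o x‖ ≤ A * 2 ^ S := by
    simp only [Pi.zero_apply, zero_mul, Finset.sum_const_zero, neg_zero, AddChar.map_zero_eq_one,
      one_mul]
    rw [Finset.sum_comm]
    refine (norm_sum_le _ _).trans ?_
    have (x : ∀ P, X P) : ‖∑ o ∈ supportedOn F T, G o x‖ ≤ 2 ^ S := by
      rw [Finset.sum_congr rfl fun o _ => hG o x, ← Complex.ofReal_sum, Complex.norm_real,
        Real.norm_of_nonneg (Finset.sum_nonneg fun o _ =>
          trace_re_nonneg (run_posSemidef _ _ _ PosSemidef.one))]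
      refine (sum_trace_run_le _ e hg hnd PosSemidef.one).trans_eq ?_
      rw [trace_one]
      simp [← Complex.ofReal_ofNat, ← Complex.ofReal_pow]
    refine (Finset.sum_le_sum fun x _ => this x).trans_eq ?_
    rw [Finset.sum_const, nsmul_eq_mul, Finset.card_univ]
  have hone (c) (hc : c ∈ supportedOn F T) (hc0 : c ≠ 0) (o : ω → F) :
      ‖ψ (-∑ k, c k * o k) * ∑ x, ψ (∑ k, c k * f x k) * G o x‖ ≤ 8 ^ q * A * θ * 2 ^ S := by
    rw [norm_mul, AddChar.norm_apply, one_mul]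
    obtain ⟨M, hM, hM1⟩ := exists_prodState_eq_one (X := X) own
    have := norm_sum_trace_run_le (fun k => e (o k)) (by positivity) (hbias c hc hc0) enc gs hg hM
    simp only [hM1] at this
    refine this.trans_eq ?_
    change 8 ^ q * (A * θ * (2 ^ S * 2 ^ S)) / 2 ^ S = _
    field_simp
  have h3 : ‖(N : ℂ) ^ k * ∑ x, G (f x) x‖ ≤
      A * 2 ^ S + N ^ k * (N ^ k * (8 ^ q * A * θ * 2 ^ S)) := by
    rw [h2, ← Finset.add_sum_erase _ _ (mem_supportedOn.2 fun k _ => rfl :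
      (0 : ω → F) ∈ supportedOn F T)]
    refine (norm_add_le _ _).trans (add_le_add hzero ?_)
    have hb (c) (hc : c ∈ (supportedOn F T).erase 0) : ‖∑ o ∈ supportedOn F T,
        ψ (-∑ k, c k * o k) * ∑ x, ψ (∑ k, c k * f x k) * G o x‖ ≤
        N ^ k * (8 ^ q * A * θ * 2 ^ S) := by
      rw [Finset.mem_erase] at hc
      refine (norm_sum_le_of_le _ fun o _ => hone c hc.2 hc.1 o).trans_eq ?_
      rw [Finset.sum_const, card_supportedOn, nsmul_eq_mul]
      push_cast
      rfl
    refine (norm_sum_le_of_le _ hb).trans ?_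
    rw [Finset.sum_const, nsmul_eq_mul]
    gcongr
    rw [hN]
    exact_mod_cast (Finset.card_erase_le).trans_eq (card_supportedOn (F := F) T)
  have h4 : N ^ k * (A * p) ≤ ‖(N : ℂ) ^ k * ∑ x, G (f x) x‖ := by
    refine le_trans ?_ (Complex.re_le_norm _)
    rw [← Complex.ofReal_pow, Complex.re_ofReal_mul, Complex.re_sum]
    gcongr
    calc A * p = ∑ _x : ∀ P, X P, p := by rw [Finset.sum_const, nsmul_eq_mul, Finset.card_univ]
      _ ≤ _ := Finset.sum_le_sum fun x _ => hp x
  have h5 := h4.trans h3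
  have hNk : 0 < N ^ k := by positivity
  refine le_of_mul_le_mul_left ?_ (mul_pos hNk hApos)
  calc N ^ k * A * p ≤ A * 2 ^ S + N ^ k * (N ^ k * (8 ^ q * A * θ * 2 ^ S)) := by
        rw [mul_assoc]; exact h5
    _ = _ := by field_simp

end Segment

/-! ### Lindsey's lemma for inner products -/

section InnerProducts

/-- The inputs of the two players for the inner product problem. -/
abbrev PairInput (F : Type*) (n l r : ℕ) : Player → Type _
  | .alice => Fin l → Fin n → F
  | .bob => Fin r → Fin n → F

noncomputable instance (F : Type*) [Fintype F] (n l r : ℕ) : ∀ P, Fintype (PairInput F n l r P)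
  | .alice => inferInstanceAs (Fintype (Fin l → Fin n → F))
  | .bob => inferInstanceAs (Fintype (Fin r → Fin n → F))

instance (F : Type*) [Nonempty F] (n l r : ℕ) : ∀ P, Nonempty (PairInput F n l r P)
  | .alice => inferInstanceAs (Nonempty (Fin l → Fin n → F))
  | .bob => inferInstanceAs (Nonempty (Fin r → Fin n → F))

variable {F : Type*} [Field F] [Fintype F] {n l r : ℕ}

/-- Pairs of inputs as dependent functions on the players. -/
def pairEquiv (X : Player → Type*) : (∀ P, X P) ≃ X .alice × X .bob where
  toFun x := (x .alice, x .bob)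
  invFun p P := match P with
    | .alice => p.1
    | .bob => p.2
  left_inv x := by ext P; cases P <;> rfl
  right_inv p := rfl

lemma sum_addChar_eq_zero {ψ : AddChar F ℂ} (hψ : ψ.IsPrimitive) {c : Fin l → Fin n → F}
    {i : Fin l} {t : Fin n} (hc : c i t ≠ 0) :
    ∑ x : Fin l → Fin n → F, ψ (∑ i, ∑ t, x i t * c i t) = 0 := by
  classical
  let χ : AddChar (Fin l → Fin n → F) ℂ :=
    { toFun := fun x => ψ (∑ i, ∑ t, x i t * c i t)
      map_zero_eq_one' := by simp
      map_add_eq_mul' := fun x y => by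
        rw [← AddChar.map_add_eq_mul]
        simp [add_mul, Finset.sum_add_distrib] }
  refine AddChar.sum_eq_zero_of_ne_one (ψ := χ) fun h => hψ hc ?_
  ext a
  have h1 : χ (Pi.single i (Pi.single t a)) = 1 := by rw [h]; rfl
  have h2 : χ (Pi.single i (Pi.single t a)) = ψ (a * c i t) := by
    change ψ (∑ i', ∑ t', (Pi.single i (Pi.single t a) : Fin l → Fin n → F) i' t' * c i' t') = _
    rw [Finset.sum_eq_single i, Finset.sum_eq_single t]
    · simp
    · intro t' _ h; simp [h]
    · simp
    · intro i' _ h; simp [h]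
    · simp
  rw [AddChar.mulShift_apply, mul_comm, ← h2, h1]
  rfl

/-- The number of tuples of vectors that satisfy a nontrivial linear relation. -/
lemma card_filter_relation_mul_le (c : Fin r → F) {j : Fin r} (hc : c j ≠ 0)
    (y : Fin r → Fin n → F) [DecidablePred fun y' : Fin r → Fin n → F =>
      ∀ t, ∑ j, c j * (y j t - y' j t) = 0] :
    (Finset.univ.filter fun y' : Fin r → Fin n → F =>
      ∀ t, ∑ j, c j * (y j t - y' j t) = 0).card * Fintype.card F ^ n ≤
      Fintype.card (Fin r → Fin n → F) := by
  classical
  have h : Fintype.card F ^ n = (Finset.univ : Finset (Fin n → F)).card := by simp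
  rw [h, ← Finset.card_product]
  refine Finset.card_le_card_of_injOn (fun p => p.1 + Pi.single j p.2)
    (fun _ _ => Finset.mem_univ _) ?_
  rintro ⟨d, v⟩ hd ⟨d', v'⟩ hd' heq
  simp only [Finset.coe_product, Finset.coe_filter, Finset.mem_univ, true_and, Finset.coe_univ,
    Set.mem_prod, Set.mem_ofPred_eq, Set.mem_univ, and_true] at hd hd'
  have hv : v = v' := by
    ext t
    have h1 (j') : d j' t + (Pi.single j v : Fin r → Fin n → F) j' t =
        d' j' t + (Pi.single j v' : Fin r → Fin n → F) j' t := congrFun (congrFun heq j') t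
    have h2 (v : Fin n → F) : ∑ j', c j' * (Pi.single j v : Fin r → Fin n → F) j' t =
        c j * v t := by
      rw [Finset.sum_eq_single j]
      · simp
      · intro j' _ h; simp [h]
      · simp
    have h3 : ∑ j', c j' * (d j' t + (Pi.single j v : Fin r → Fin n → F) j' t) =
        ∑ j', c j' * (d' j' t + (Pi.single j v' : Fin r → Fin n → F) j' t) :=
      Finset.sum_congr rfl fun j' _ => by rw [h1]
    have h4 := hd t
    have h5 := hd' t
    simp only [mul_sub, Finset.sum_sub_distrib, sub_eq_zero] at h4 h5
    simp only [mul_add, Finset.sum_add_distrib, h2, ← h4, ← h5] at h3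
    exact mul_left_cancel₀ hc (add_left_cancel h3)
  subst hv
  exact Prod.ext (add_right_cancel heq) rfl

/-- Lindsey's lemma for the inner products: a nontrivial character of the outputs is a bilinear
form of rank at least `n`, so its correlation with products is at most `|F| ^ (-n / 2)`. -/
lemma norm_sum_sum_addChar_le {ψ : AddChar F ℂ} (hψ : ψ.IsPrimitive) {c : Fin l × Fin r → F}
    (hc : c ≠ 0) {a : (Fin l → Fin n → F) → ℝ} {b : (Fin r → Fin n → F) → ℝ} {α β : ℝ}
    (ha : ∀ x, 0 ≤ a x) (ha' : ∀ x, a x ≤ α) (hb : ∀ y, 0 ≤ b y) (hb' : ∀ y, b y ≤ β) :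
    ‖∑ x, ∑ y, ψ (∑ k, c k * innerProd (x k.1) (y k.2)) * ((a x * b y : ℝ) : ℂ)‖ ≤
      Fintype.card (Fin l → Fin n → F) * Fintype.card (Fin r → Fin n → F) /
        √((Fintype.card F : ℝ) ^ n) * (α * β) := by
  classical
  obtain ⟨⟨i, j⟩, hij⟩ := Function.ne_iff.1 hc
  set A : ℝ := (Fintype.card (Fin l → Fin n → F) : ℝ) with hA
  set B : ℝ := (Fintype.card (Fin r → Fin n → F) : ℝ) with hB
  set N : ℝ := (Fintype.card F : ℝ) with hN
  have hNpos : 0 < N := by rw [hN]; exact_mod_cast Fintype.card_pos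
  have hα : 0 ≤ α := (ha 0).trans (ha' 0)
  have hβ : 0 ≤ β := (hb 0).trans (hb' 0)
  let K (x : Fin l → Fin n → F) (y : Fin r → Fin n → F) : ℂ :=
    ψ (∑ k, c k * innerProd (x k.1) (y k.2))
  let R (x : Fin l → Fin n → F) : ℂ := ∑ y, K x y * (b y : ℂ)
  have hform (x : Fin l → Fin n → F) (y y' : Fin r → Fin n → F) :
      K x y * (starRingEnd ℂ) (K x y') =
        ψ (∑ i, ∑ t, x i t * ∑ j, c (i, j) * (y j t - y' j t)) := by
    simp only [K]
    rw [← AddChar.map_neg_eq_conj, ← AddChar.map_add_eq_mul, ← sub_eq_add_neg,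
      ← Finset.sum_sub_distrib]
    congr 1
    simp only [innerProd, Fintype.sum_prod_type, ← mul_sub, ← Finset.sum_sub_distrib,
      Finset.mul_sum]
    refine Finset.sum_congr rfl fun i _ => ?_
    rw [Finset.sum_comm]
    exact Finset.sum_congr rfl fun t _ => Finset.sum_congr rfl fun j _ => by ring
  have hK (y y' : Fin r → Fin n → F) : ‖∑ x, K x y * (starRingEnd ℂ) (K x y')‖ ≤
      if ∀ t, ∑ j, c (i, j) * (y j t - y' j t) = 0 then A else 0 := by
    split_ifs with h
    · refine (norm_sum_le _ _).trans_eq ?_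
      simp [K, AddChar.norm_apply, hA]
    · push Not at h
      obtain ⟨t, ht⟩ := h
      simp only [hform]
      rw [sum_addChar_eq_zero hψ (c := fun i t => ∑ j, c (i, j) * (y j t - y' j t)) ht, norm_zero]
  have hR : ∑ x, ‖R x‖ ^ 2 ≤ β ^ 2 * A * (B * B / N ^ n) := by
    have h1 : ((∑ x, ‖R x‖ ^ 2 : ℝ) : ℂ) =
        ∑ y, ∑ y', ((b y * b y' : ℝ) : ℂ) * ∑ x, K x y * (starRingEnd ℂ) (K x y') := by
      push_cast
      have hx (x : Fin l → Fin n → F) : (‖R x‖ : ℂ) ^ 2 = ∑ y, ∑ y', (b y * b y' : ℂ) *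
          (K x y * (starRingEnd ℂ) (K x y')) := by
        rw [← Complex.mul_conj', map_sum, Finset.sum_mul_sum]
        refine Finset.sum_congr rfl fun y _ => Finset.sum_congr rfl fun y' _ => ?_
        rw [map_mul, Complex.conj_ofReal]
        ring
      simp only [hx, Finset.mul_sum]
      rw [Finset.sum_comm]
      exact Finset.sum_congr rfl fun y _ => Finset.sum_comm
    have h2 : (∑ x, ‖R x‖ ^ 2 : ℝ) = ‖((∑ x, ‖R x‖ ^ 2 : ℝ) : ℂ)‖ := by
      rw [Complex.norm_real, Real.norm_of_nonneg (by positivity)]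
    rw [h2, h1]
    calc _ ≤ ∑ y : Fin r → Fin n → F, ∑ y' : Fin r → Fin n → F, (β * β) *
          (if ∀ t, ∑ j, c (i, j) * (y j t - y' j t) = 0 then A else 0) := by
          refine norm_sum_le_of_le _ fun y _ => norm_sum_le_of_le _ fun y' _ => ?_
          rw [norm_mul, Complex.norm_real, Real.norm_of_nonneg (mul_nonneg (hb y) (hb y'))]
          exact mul_le_mul (mul_le_mul (hb' y) (hb' y') (hb y') hβ) (hK y y') (norm_nonneg _)
            (by positivity)
      _ = ∑ y : Fin r → Fin n → F, β * β * (((Finset.univ.filter fun y' : Fin r → Fin n → F =>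
            ∀ t, ∑ j, c (i, j) * (y j t - y' j t) = 0).card : ℝ) * A) := by
          refine Finset.sum_congr rfl fun y _ => ?_
          rw [← Finset.mul_sum, ← Finset.sum_filter, Finset.sum_const, nsmul_eq_mul]
      _ ≤ ∑ _y : Fin r → Fin n → F, β * β * (B / N ^ n * A) := by
          refine Finset.sum_le_sum fun y _ => ?_
          gcongr
          rw [le_div_iff₀ (by positivity), hN, hB]
          exact_mod_cast card_filter_relation_mul_le (fun j => c (i, j)) hij y
      _ = _ := by
          rw [Finset.sum_const, nsmul_eq_mul, Finset.card_univ]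
          ring
  have h1 : ∑ x, ∑ y, ψ (∑ k, c k * innerProd (x k.1) (y k.2)) * ((a x * b y : ℝ) : ℂ) =
      ∑ x, (a x : ℂ) * R x := by
    refine Finset.sum_congr rfl fun x _ => ?_
    rw [Finset.mul_sum]
    refine Finset.sum_congr rfl fun y _ => ?_
    push_cast
    ring
  rw [h1]
  have h2 : ‖∑ x, (a x : ℂ) * R x‖ ≤ ∑ x, a x * ‖R x‖ := by
    refine norm_sum_le_of_le _ fun x _ => ?_
    rw [norm_mul, Complex.norm_real, Real.norm_of_nonneg (ha x)]
  refine h2.trans (abs_le_of_sq_le_sq' ?_ (by positivity)).2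
  have h3 : ∑ x, a x ^ 2 ≤ A * α ^ 2 := by
    calc _ ≤ ∑ _x : Fin l → Fin n → F, α ^ 2 :=
          Finset.sum_le_sum fun x _ => pow_le_pow_left₀ (ha x) (ha' x) 2
      _ = _ := by rw [Finset.sum_const, nsmul_eq_mul, Finset.card_univ]
  calc (∑ x, a x * ‖R x‖) ^ 2 ≤ (∑ x, a x ^ 2) * ∑ x, ‖R x‖ ^ 2 :=
        Finset.sum_mul_sq_le_sq_mul_sq _ _ _
    _ ≤ (A * α ^ 2) * (β ^ 2 * A * (B * B / N ^ n)) := by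
        gcongr
    _ = _ := by
        rw [mul_pow, div_pow, Real.sq_sqrt (by positivity)]
        ring

lemma biasAtMost_addChar_innerProd {ψ : AddChar F ℂ} (hψ : ψ.IsPrimitive)
    {c : Fin l × Fin r → F} (hc : c ≠ 0) :
    BiasAtMost (X := PairInput F n l r)
      (fun x => ψ (∑ k, c k * innerProd (x .alice k.1) (x .bob k.2)))
      (Fintype.card (∀ P, PairInput F n l r P) * (1 / √((Fintype.card F : ℝ) ^ n))) := by
  intro a α ha ha'
  have h := norm_sum_sum_addChar_le hψ hc (ha .alice) (ha' .alice) (ha .bob) (ha' .bob)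
  rw [← Fintype.sum_prod_type' (f := fun (x : Fin l → Fin n → F) (y : Fin r → Fin n → F) =>
    ψ (∑ k, c k * innerProd (x k.1) (y k.2)) *
      ((a .alice x * a .bob y : ℝ) : ℂ))] at h
  have hcard : (Fintype.card (∀ P, PairInput F n l r P) : ℝ) =
      Fintype.card (Fin l → Fin n → F) * Fintype.card (Fin r → Fin n → F) := by
    rw [Fintype.card_congr (pairEquiv (PairInput F n l r)), Fintype.card_prod]
    push_cast
    rfl
  rw [hcard, mul_one_div]
  refine le_of_eq_of_le (congrArg norm ?_) h
  exact Equiv.sum_comp (pairEquiv (PairInput F n l r)) fun p =>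
    ψ (∑ k, c k * innerProd (p.1 k.1) (p.2 k.2)) * ((a .alice p.1 * a .bob p.2 : ℝ) : ℂ)

end InnerProducts

end CommGate

/-! ### The lower bound -/

namespace CommGate

section Counting

variable {S : ℕ} {Idx : Player → Type} {ω : Type} {L : ℕ}

lemma exists_append_of_le_length_outputLabels {k : ℕ} {gs : List (CommGate S Idx ω L)}
    (h : k ≤ (outputLabels gs).length) :
    ∃ a b, gs = a ++ b ∧ (outputLabels a).length = k := by
  induction gs generalizing k with
  | nil =>
    obtain rfl : k = 0 := by simpa [outputLabels] using h
    exact ⟨[], [], rfl, rfl⟩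
  | cons g gs ih =>
    rcases k with _ | k
    · exact ⟨[], g :: gs, rfl, rfl⟩
    · cases hg : g.outputLabel with
      | none =>
        rw [outputLabels, List.filterMap_cons_none hg] at h
        obtain ⟨a, b, rfl, hab⟩ := ih h
        exact ⟨g :: a, b, rfl, by rw [outputLabels, List.filterMap_cons_none hg, hab]⟩
      | some j =>
        rw [outputLabels, List.filterMap_cons_some hg, List.length_cons] at h
        obtain ⟨a, b, rfl, hab⟩ := ih (Nat.le_of_succ_le_succ h)
        exact ⟨g :: a, b, rfl, by
          rw [outputLabels, List.filterMap_cons_some hg, List.length_cons, hab]⟩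

/-- If all segments with `k` outputs have cost at least `q`, then a circuit with at least `m * k`
outputs has cost at least `m * q`. -/
lemma mul_le_cost {k : ℕ} {q : ℝ} (m : ℕ) {gs : List (CommGate S Idx ω L)}
    (hseg : ∀ pre seg post, gs = pre ++ seg ++ post → (outputLabels seg).length = k →
      q ≤ (seg.map cost).sum)
    (hm : m * k ≤ (outputLabels gs).length) : m * q ≤ (gs.map cost).sum := by
  induction m generalizing gs with
  | zero =>
    rw [Nat.cast_zero, zero_mul]
    exact Nat.cast_nonneg _
  | succ m ih =>
    obtain ⟨a, b, rfl, ha⟩ := exists_append_of_le_length_outputLabels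
      (k := k) (gs := gs) (le_trans (Nat.le_mul_of_pos_left k m.succ_pos) hm)
    have hb : m * k ≤ (outputLabels b).length := by
      have h : outputLabels (a ++ b) = outputLabels a ++ outputLabels b := List.filterMap_append
      rw [h, List.length_append, ha, Nat.succ_mul, Nat.add_comm] at hm
      exact Nat.le_of_add_le_add_left hm
    have h1 := hseg [] a b rfl ha
    have h2 := ih (fun pre seg post h => hseg (a ++ pre) seg post (by rw [h]; simp)) hb
    rw [List.map_append, List.sum_append, Nat.cast_add, Nat.cast_add, Nat.cast_one]
    linarith

lemma length_outputLabels_mul_le_cost (gs : List (CommGate S Idx ω L)) :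
    (outputLabels gs).length * L ≤ (gs.map cost).sum := by
  induction gs with
  | nil => simp [outputLabels]
  | cons g gs ih =>
    rw [List.map_cons, List.sum_cons]
    cases g with
    | output P reg k =>
      have h : outputLabels (output P reg k :: gs) = k :: outputLabels gs :=
        List.filterMap_cons_some rfl
      rw [h, List.length_cons, Nat.succ_mul, add_comm]
      exact Nat.add_le_add_left ih _
    | _ =>
      rw [outputLabels, List.filterMap_cons_none rfl]
      exact ih.trans (Nat.le_add_left _ _)

end Counting

end CommGate

section LowerBound

open CommGate Matrix

open scoped ComplexOrder in
lemma initialState_posSemidef (S : ℕ) : (QProtocol.initialState S).PosSemidef := by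
  rw [QProtocol.initialState, ← Matrix.diagonal_single]
  refine PosSemidef.diagonal fun i => ?_
  by_cases h : i = fun _ => false
  · subst h; simp
  · simp [h]

lemma elemBits_le_space {F : Type*} [Fintype F] {n r S : ℕ} (hn : 1 ≤ n) (hr : 1 ≤ r)
    (π : PairProtocol F n n r S) : elemBits F ≤ S := by
  have h := π.mem_outputs (⟨0, hn⟩, ⟨0, hr⟩)
  rw [List.mem_filterMap] at h
  obtain ⟨g, -, hg⟩ := h
  cases g with
  | output P reg k => simpa using Fintype.card_le_of_embedding reg
  | _ => simp [outputLabel] at hg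

lemma length_outputLabels_gates {F : Type*} [Fintype F] {n r S : ℕ} (π : PairProtocol F n n r S) :
    (outputLabels π.gates).length = n * r := by
  rw [← List.toFinset_card_of_nodup π.nodup_outputs,
    Finset.eq_univ_iff_forall.2 fun k => List.mem_toFinset.2 (π.mem_outputs k)]
  simp

variable {F : Type*} [Field F] [Fintype F] {n r S : ℕ}

lemma two_rpow_logb_card (F : Type*) [Field F] [Fintype F] :
    (2 : ℝ) ^ Real.logb 2 (Fintype.card F) = Fintype.card F :=
  Real.rpow_logb (by norm_num) (by norm_num) (by exact_mod_cast Fintype.card_pos)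

lemma one_le_logb_card (F : Type*) [Field F] [Fintype F] :
    1 ≤ Real.logb 2 (Fintype.card F) := by
  rw [Real.le_logb_iff_rpow_le (by norm_num) (by exact_mod_cast Fintype.card_pos), Real.rpow_one]
  exact_mod_cast Fintype.one_lt_card (α := F)

lemma logb_card_le_elemBits (F : Type*) [Field F] [Fintype F] :
    Real.logb 2 (Fintype.card F) ≤ elemBits F := by
  rw [Real.logb_le_iff_le_rpow (by norm_num) (by exact_mod_cast Fintype.card_pos),
    Real.rpow_natCast]
  exact_mod_cast Nat.le_pow_clog (by norm_num) _

/-- A segment of a protocol that produces sufficiently many outputs for a starting state of `S`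
qubits to be of no help communicates a constant fraction of the bits in a vector. -/
lemma PairProtocol.Computes.le_cost_segment {π : PairProtocol F n n r S}
    {e : F ↪ (Fin (elemBits F) → Bool)} {p : ℝ} (hp : 1 / 2 ≤ p) (h : π.Computes e p)
    {pre seg post : List (CommGate S (InputPos n n r (elemBits F)) (Fin n × Fin r) (elemBits F))}
    (hsplit : π.gates = pre ++ seg ++ post)
    (hk : S + 2 ≤ (outputLabels seg).length * Real.logb 2 (Fintype.card F)) :
    n * Real.logb 2 (Fintype.card F) / 2 ≤ S + 2 +
      (outputLabels seg).length * Real.logb 2 (Fintype.card F) + 3 * (seg.map cost).sum := by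
  set k := (outputLabels seg).length
  set q := (seg.map cost).sum
  set N : ℝ := (Fintype.card F : ℝ)
  set ℓ := Real.logb 2 N
  have hN : (2 : ℝ) ^ ℓ = N := two_rpow_logb_card F
  have hlegal := π.legal
  rw [hsplit] at hlegal
  have hnd := π.nodup_outputs
  rw [hsplit, List.filterMap_append, List.filterMap_append] at hnd
  have hndseg : (outputLabels seg).Nodup := (List.nodup_append'.1 (List.nodup_append'.1 hnd).1).2.1
  have hψ := AddChar.FiniteField.primitiveChar_to_Complex_isPrimitive F
  have hmain := le_of_forall_le_trace_run (X := PairInput F n n r) (ω := Fin n × Fin r)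
    (p := p) (θ := 1 / √(N ^ n)) hψ e
    (fun P x => match P with
      | .alice => inputBits (r := r) e x (fun _ _ => 0) .alice
      | .bob => inputBits (l := n) e (fun _ _ => 0) x .bob)
    (fun x k => innerProd (x .alice k.1) (x .bob k.2))
    ((legalFrom_append.1 (legalFrom_append.1 hlegal).1).2) hndseg (by positivity)
    (fun x => by
      refine (h (x .alice) (x .bob)).trans ?_
      rw [QProtocol.outputProb, ← run_eq_foldl, hsplit]
      refine (trace_run_segment_le _ _ hlegal (initialState_posSemidef S) ?_).trans_eq ?_
      · simp [QProtocol.initialState]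
      · congr 4
        ext P
        cases P <;> rfl)
    (fun c _ hc => biasAtMost_addChar_innerProd hψ hc)
  -- the trivial character accounts for at most half of the success probability
  have h1 : (2 : ℝ) ^ S * (1 / N ^ k) ≤ 1 / 4 := by
    rw [← hN, ← Real.rpow_mul_natCast (by norm_num), mul_one_div, div_le_div_iff₀ (by positivity)
      (by norm_num), one_mul]
    calc (2 : ℝ) ^ S * 4 = 2 ^ ((S : ℝ) + 2) := by
          rw [Real.rpow_add (by norm_num), Real.rpow_natCast]; norm_num
      _ ≤ _ := Real.rpow_le_rpow_of_exponent_le (by norm_num) (by linarith)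
  have h2 : 1 / 4 ≤ 2 ^ S * (N ^ k * 8 ^ q * (1 / √(N ^ n))) := by
    have := hp.trans hmain
    rw [mul_add] at this
    linarith
  have h3 : √(N ^ n) = (2 : ℝ) ^ (n * ℓ / 2) := by
    rw [Real.sqrt_eq_rpow, ← hN, ← Real.rpow_mul_natCast (by norm_num),
      ← Real.rpow_mul (by norm_num)]
    congr 1
    ring
  have h4 : 2 ^ S * (N ^ k * 8 ^ q) = (2 : ℝ) ^ (S + k * ℓ + 3 * q) := by
    have hNk : N ^ k = (2 : ℝ) ^ (k * ℓ) := by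
      rw [← hN, ← Real.rpow_mul_natCast (by norm_num), mul_comm]
    have h8 : (8 : ℝ) ^ q = 2 ^ (3 * q : ℝ) := by
      rw [Real.rpow_mul (by norm_num), Real.rpow_natCast]
      norm_num
    rw [Real.rpow_add (by norm_num), Real.rpow_add (by norm_num), Real.rpow_natCast, hNk, h8,
      mul_assoc]
  rw [h3, mul_one_div, ← mul_div_assoc, h4, ← Real.rpow_sub (by norm_num),
    show (1 : ℝ) / 4 = 2 ^ (-2 : ℝ) by norm_num [Real.rpow_neg],
    Real.rpow_le_rpow_left_iff (by norm_num)] at h2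
  linarith

/-- The communication-space tradeoff for `n * r` inner products. -/
theorem PairProtocol.Computes.le_communication {π : PairProtocol F n n r S}
    {e : F ↪ (Fin (elemBits F) → Bool)} {p : ℝ} (hp : 1 / 2 ≤ p) (h : π.Computes e p)
    (hn : 1 ≤ n) (hr : 1 ≤ r) (hS : 1 ≤ S) :
    1 / 96 * (n ^ 2 * r * Real.logb 2 (Fintype.card F) ^ 2 / S) ≤ (π.communication : ℝ) := by
  have hℓ := one_le_logb_card F
  have hL := logb_card_le_elemBits F
  have hLS : (elemBits F : ℝ) ≤ S := by exact_mod_cast elemBits_le_space hn hr π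
  set ℓ := Real.logb 2 (Fintype.card F)
  have hn' : (1 : ℝ) ≤ n := by exact_mod_cast hn
  have hr' : (1 : ℝ) ≤ r := by exact_mod_cast hr
  have hS' : (1 : ℝ) ≤ S := by exact_mod_cast hS
  by_cases hbig : n * ℓ < 28 * S
  · -- the outputs alone are sufficiently many
    have h1 : ((n * r : ℕ) * elemBits F : ℝ) ≤ π.communication := by
      have := length_outputLabels_mul_le_cost π.gates
      rw [length_outputLabels_gates] at this
      exact_mod_cast this
    refine le_trans ?_ h1
    push_cast
    have h2 : n ^ 2 * r * ℓ ^ 2 / S ≤ 28 * (n * r * ℓ) := by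
      rw [div_le_iff₀ (by linarith)]
      have : 0 ≤ n * r * ℓ := by positivity
      nlinarith
    have h3 : n * r * ℓ ≤ n * r * elemBits F := by gcongr
    have : 0 ≤ n * r * ℓ := by positivity
    linarith
  · rw [not_lt] at hbig
    -- a starting state of `S` qubits does not help to guess `k` outputs
    set k := ⌈((S : ℝ) + 2) / ℓ⌉₊
    have hk1 : (S : ℝ) + 2 ≤ k * ℓ := by
      have := Nat.le_ceil (((S : ℝ) + 2) / ℓ)
      rwa [div_le_iff₀ (by linarith)] at this
    have hk2 : k * ℓ ≤ 4 * S := by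
      have := (Nat.ceil_lt_add_one (a := ((S : ℝ) + 2) / ℓ) (by positivity)).le
      have h2 : k * ℓ ≤ (((S : ℝ) + 2) / ℓ + 1) * ℓ := by gcongr
      rw [add_mul, div_mul_cancel₀ _ (by linarith)] at h2
      linarith
    have hkpos : (0 : ℝ) < k := by
      by_contra hk
      have : (k : ℝ) * ℓ ≤ 0 := mul_nonpos_of_nonpos_of_nonneg (not_lt.1 hk) (by linarith)
      linarith
    have hkn : 2 * (k : ℝ) ≤ n * r := by
      have h7 : 7 * (k : ℝ) ≤ n := by
        refine le_of_mul_le_mul_right ?_ (show (0 : ℝ) < ℓ by linarith)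
        linarith
      nlinarith
    have hcost := mul_le_cost (k := k) (q := n * ℓ / 12) (n * r / k) (gs := π.gates)
      (fun pre seg post hsplit hlen => by
        -- `n * ℓ / 2 - k * ℓ - (S + 2) ≥ n * ℓ / 2 - 7 * S ≥ n * ℓ / 4`
        have := h.le_cost_segment hp hsplit (by rw [hlen]; exact hk1)
        rw [hlen] at this
        change (n : ℝ) * ℓ / 2 ≤ S + 2 + k * ℓ + _ at this
        linarith)
      (by rw [length_outputLabels_gates]; exact Nat.div_mul_le_self _ _)
    refine le_trans ?_ hcost
    have hm : (n * r : ℝ) / (2 * k) ≤ ((n * r / k : ℕ) : ℝ) := by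
      rw [div_le_iff₀ (by positivity)]
      have h1 : n * r < (n * r / k + 1) * k := by
        have hk0 : 0 < k := by exact_mod_cast hkpos
        rw [mul_comm (_ + 1)]
        exact Nat.lt_mul_div_succ _ hk0
      have h2 : (n * r : ℝ) ≤ (((n * r / k : ℕ) : ℝ) + 1) * k := by exact_mod_cast h1.le
      linarith
    have hm2 : (n * r * ℓ : ℝ) / (8 * S) ≤ (n * r : ℝ) / (2 * k) := by
      rw [div_le_div_iff₀ (by positivity) (by positivity)]
      have : 0 ≤ (n * r : ℝ) := by positivity
      nlinarith
    calc 1 / 96 * (n ^ 2 * r * ℓ ^ 2 / S) = (n * r * ℓ : ℝ) / (8 * S) * (n * ℓ / 12) := by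
          field_simp
          norm_num
      _ ≤ _ := by
          gcongr
          exact hm2.trans hm

end LowerBound

/-! ### Deterministic circuits on basis states -/

namespace CommGate

section Runs

open Matrix

variable {S : ℕ} {Idx : Player → Type} {ω : Type} {L : ℕ}

lemma conj_single_of_apply {f : BasisLabel S → BasisLabel S} {M : QState S}
    (hM : ∀ z w, M z w = if z = f w then 1 else 0) (a : BasisLabel S) :
    M * Matrix.single a a 1 * Mᴴ = Matrix.single (f a) (f a) 1 := by
  ext z w
  rw [Matrix.mul_assoc, mul_apply, Finset.sum_eq_single a]
  · rw [mul_apply, Finset.sum_eq_single a]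
    · simp only [hM, conjTranspose_apply, Matrix.single_apply, and_self, if_true, one_mul,
        apply_ite star, star_one, star_zero]
      by_cases hz : z = f a <;> by_cases hw : w = f a <;> simp [hz, hw, eq_comm]
    · intro c _ hc
      simp [hc.symm]
    · simp
  · intro c _ hc
    rw [mul_apply, Finset.sum_eq_zero, mul_zero]
    intro d _
    simp [hc.symm]
  · simp

/-- The gate in which a player, who holds all qubits, permutes the basis states by `σ`. -/
def permGate (P : Player) (σ : Equiv.Perm (BasisLabel S)) : CommGate S Idx ω L :=
  let E : ({q // q ∈ (Finset.univ : Finset (Fin S))} → Bool) ≃ BasisLabel S :=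
    (Equiv.subtypeUnivEquiv fun q => Finset.mem_univ q).arrowCongr (Equiv.refl Bool)
  let τ : Equiv.Perm ({q // q ∈ (Finset.univ : Finset (Fin S))} → Bool) :=
    (E.trans σ.symm).trans E.symm
  unitary P Finset.univ ⟨τ.permMatrix ℂ, by
    rw [Matrix.mem_unitaryGroup_iff, star_eq_conjTranspose, conjTranspose_permMatrix,
      ← Matrix.permMatrix_mul]
    simp⟩

/-- The list `gs` of classical gates is legal for the owners `own`, leads to the owners `own'`, and
maps the basis state `z` to the basis state `z'`, with all outputs equal to those in `o`. -/
structure Runs (x : ∀ P, Idx P → Bool) (o : ω → Fin L → Bool) (gs : List (CommGate S Idx ω L))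
    (own : Fin S → Player) (z : BasisLabel S) (own' : Fin S → Player) (z' : BasisLabel S) :
    Prop where
  classical : ∀ g ∈ gs, g.IsClassical
  legal : LegalFrom own gs
  owner : ownerAfter own gs = own'
  state : run x o gs (Matrix.single z z 1) = Matrix.single z' z' 1

variable {x : ∀ P, Idx P → Bool} {o : ω → Fin L → Bool}

lemma Runs.nil (own : Fin S → Player) (z : BasisLabel S) :
    Runs x o ([] : List (CommGate S Idx ω L)) own z own z :=
  ⟨by simp, trivial, rfl, rfl⟩

lemma Runs.append {gs hs : List (CommGate S Idx ω L)} {own own' own'' : Fin S → Player}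
    {z z' z'' : BasisLabel S} (h : Runs x o gs own z own' z')
    (h' : Runs x o hs own' z' own'' z'') : Runs x o (gs ++ hs) own z own'' z'' where
  classical g hg := (List.mem_append.1 hg).elim (h.classical g) (h'.classical g)
  legal := legalFrom_append.2 ⟨h.legal, h.owner ▸ h'.legal⟩
  owner := by rw [← h'.owner, ← h.owner, ownerAfter, List.foldl_append]; rfl
  state := by rw [run_append, h.state, h'.state]

lemma Runs.singleton {g : CommGate S Idx ω L} {own : Fin S → Player} {z z' : BasisLabel S}
    (hc : g.IsClassical) (hl : g.Legal own)
    (h : g.act x o (Matrix.single z z 1) = Matrix.single z' z' 1) :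
    Runs x o [g] own z (g.newOwner own) z' :=
  ⟨by simpa using hc, ⟨hl, trivial⟩, rfl, h⟩

lemma runs_fresh (P : Player) (q : Fin S) (own : Fin S → Player) (z : BasisLabel S) :
    Runs x o [(fresh P q : CommGate S Idx ω L)] own z (Function.update own q P)
      (Function.update z q false) := by
  refine Runs.singleton trivial trivial ?_
  have h (u : BasisLabel S) (b : Bool) : (z = Function.update u q b ∧ u q = false) ↔
      (Function.update z q false = u ∧ z q = b) := by
    constructor
    · rintro ⟨rfl, hu⟩
      rw [Function.update_idem, ← hu, Function.update_eq_self, Function.update_self]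
      exact ⟨rfl, rfl⟩
    · rintro ⟨rfl, rfl⟩
      rw [Function.update_idem, Function.update_eq_self, Function.update_self]
      exact ⟨rfl, rfl⟩
  ext u w
  change (if u q = false ∧ w q = false then
    ∑ b : Bool, Matrix.single z z (1 : ℂ) (Function.update u q b) (Function.update w q b)
      else 0) = _
  simp only [Matrix.single_apply]
  by_cases hu : u q = false
  · by_cases hw : w q = false
    · have h' (u : BasisLabel S) (hu : u q = false) (b : Bool) :
          z = Function.update u q b ↔ Function.update z q false = u ∧ z q = b := by
        rw [← h, and_iff_left hu]
      rw [if_pos ⟨hu, hw⟩, Finset.sum_eq_single (z q)]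
      · simp only [h' u hu, h' w hw, and_true]
      · intro b _ hb
        rw [if_neg]
        rintro ⟨h1, -⟩
        exact hb ((h' u hu b).1 h1).2.symm
      · simp
    · rw [if_neg fun h => hw h.2, if_neg]
      rintro ⟨-, rfl⟩
      simp at hw
  · rw [if_neg fun h => hu h.1, if_neg]
    rintro ⟨rfl, -⟩
    simp at hu

lemma runs_query (P : Player) (t : Fin S) (p : Idx P) {own : Fin S → Player} (ht : own t = P)
    {z : BasisLabel S} (hz : z t = false) :
    Runs x o [(query P t ∅ fun _ => some p : CommGate S Idx ω L)] own z own
      (Function.update z t (x P p)) := by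
  refine Runs.singleton trivial ⟨ht, by simp, by simp⟩ ?_
  have h := conj_single_of_apply (M := queryMatrix (x P) t ∅ fun _ => some p)
    (f := queryLabel (x P) t ∅ fun _ => some p) (fun _ _ => rfl) z
  rw [act, h]
  simp [queryLabel, hz]

lemma runs_send (q : Fin S) (own : Fin S → Player) (z : BasisLabel S) :
    Runs x o [(send q : CommGate S Idx ω L)] own z (Function.update own q (own q).other) z :=
  Runs.singleton trivial trivial rfl

lemma runs_permGate (P : Player) (σ : Equiv.Perm (BasisLabel S)) (z : BasisLabel S) :
    Runs x o [(permGate P σ : CommGate S Idx ω L)] (fun _ => P) z (fun _ => P) (σ z) := by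
  refine Runs.singleton ⟨_, rfl⟩ (fun _ _ => rfl) ?_
  refine conj_single_of_apply (fun u w => ?_) z
  simp only [extend, Finset.mem_univ, not_true_eq_false, false_imp_iff, implies_true, if_true]
  rw [Equiv.Perm.permMatrix, PEquiv.toMatrix_apply]
  simp only [Equiv.toPEquiv_apply, Option.mem_def, Option.some.injEq, Equiv.trans_apply,
    Equiv.symm_apply_eq]
  congr 1

lemma runs_output (P : Player) (reg : Fin L ↪ Fin S) (k : ω) {own : Fin S → Player}
    (hown : ∀ b, own (reg b) = P) {z : BasisLabel S} (hz : ∀ b, z (reg b) = o k b) :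
    Runs x o [(output P reg k : CommGate S Idx ω L)] own z
      ((output P reg k : CommGate S Idx ω L).newOwner own) z := by
  refine Runs.singleton trivial hown ?_
  rw [act_output]
  ext u w
  by_cases hu : z = u
  · by_cases hw : z = w
    · subst hu hw
      simp [scaleBy, regInd, hz]
    · simp [scaleBy, hw]
  · simp [scaleBy, hu]

/-- Lists of gates that set single qubits combine to lists of gates that set registers. -/
lemma runs_flatMap {ι : Type} [Fintype ι] (tgt : ι ↪ Fin S) (G : ι → List (CommGate S Idx ω L))
    (P : Player) (c : ι → Bool)
    (h : ∀ a own z, Runs x o (G a) own z (Function.update own (tgt a) P)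
      (Function.update z (tgt a) (c a))) (own : Fin S → Player) (z : BasisLabel S) :
    Runs x o (Finset.univ.toList.flatMap G) own z (Function.extend tgt (fun _ => P) own)
      (Function.extend tgt c z) := by
  classical
  have key (l : List ι) (own : Fin S → Player) (z : BasisLabel S) : Runs x o (l.flatMap G) own z
      (fun q => if q ∈ l.map tgt then P else own q)
      (fun q => if q ∈ l.map tgt then Function.extend tgt c z q else z q) := by
    induction l generalizing own z with
    | nil => simpa using Runs.nil own z
    | cons a l ih =>
      have := (h a own z).append (ih _ _)
      rw [List.flatMap_cons]
      convert this using 1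
      · ext q
        by_cases hq : q = tgt a
        · subst hq; simp
        · by_cases hql : q ∈ l.map tgt <;> simp_all
      · ext q
        by_cases hq : q = tgt a
        · subst hq
          simp [tgt.injective.extend_apply]
        · by_cases hql : q ∈ l.map tgt
          · obtain ⟨a', -, rfl⟩ := List.mem_map.1 hql
            simp [hql, tgt.injective.extend_apply, tgt.injective.eq_iff]
          · simp [hq, hql]
  convert key Finset.univ.toList own z using 1
  · ext q
    by_cases hq : ∃ a, tgt a = q
    · obtain ⟨a, rfl⟩ := hq
      simp [tgt.injective.extend_apply]
    · rw [Function.extend_apply' _ _ _ hq]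
      simp_all
  · ext q
    by_cases hq : ∃ a, tgt a = q
    · obtain ⟨a, rfl⟩ := hq
      simp
    · rw [Function.extend_apply' _ _ _ hq]
      simp_all

end Runs

end CommGate

/-! ### A circuit for a block of inner products -/

namespace CommGate

section BlockCircuit

variable {S b L : ℕ}

/-- Addresses of the memory for a block of `b` rows: `b` registers that accumulate inner products,
`b` registers for entries of the vectors of Alice, and one for an entry of a vector of Bob. -/
abbrev Slot (b L : ℕ) := (Fin b × Fin L) ⊕ (Fin b × Fin L) ⊕ Fin L

/-- The accumulators as qubits. -/
def accQubits (R : Slot b L ↪ Fin S) : Fin b × Fin L ↪ Fin S :=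
  Function.Embedding.inl.trans R

/-- The registers for entries of the vectors of Alice. -/
def aliceQubits (R : Slot b L ↪ Fin S) : Fin b × Fin L ↪ Fin S :=
  (Function.Embedding.inl.trans Function.Embedding.inr).trans R

/-- The register for an entry of a vector of Bob. -/
def bobQubits (R : Slot b L ↪ Fin S) : Fin L ↪ Fin S :=
  (Function.Embedding.inr.trans Function.Embedding.inr).trans R

/-- A single accumulator. -/
def accReg (R : Slot b L ↪ Fin S) (i : Fin b) : Fin L ↪ Fin S :=
  (Function.Embedding.sectR i (Fin L)).trans (accQubits R)

/-- The basis state with the given contents of the registers, where all other qubits are `0`. -/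
noncomputable def memLabel (R : Slot b L ↪ Fin S) (s u : Fin b → Fin L → Bool)
    (v : Fin L → Bool) : BasisLabel S :=
  Function.extend R (Sum.elim (fun p => s p.1 p.2) (Sum.elim (fun p => u p.1 p.2) v))
    fun _ => false

lemma memLabel_apply (R : Slot b L ↪ Fin S) (s u : Fin b → Fin L → Bool) (v : Fin L → Bool)
    (p : Slot b L) : memLabel R s u v (R p) =
      Sum.elim (fun p => s p.1 p.2) (Sum.elim (fun p => u p.1 p.2) v) p :=
  R.injective.extend_apply _ _ _

lemma memLabel_apply_of_notMem (R : Slot b L ↪ Fin S) (s u : Fin b → Fin L → Bool)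
    (v : Fin L → Bool) {q : Fin S} (hq : ¬∃ p, R p = q) : memLabel R s u v q = false :=
  Function.extend_apply' _ _ _ hq

lemma memLabel_accReg (R : Slot b L ↪ Fin S) (s u : Fin b → Fin L → Bool) (v : Fin L → Bool)
    (i : Fin b) (a : Fin L) : memLabel R s u v (accReg R i a) = s i a :=
  memLabel_apply R s u v (.inl (i, a))

lemma extend_bobQubits (R : Slot b L ↪ Fin S) (s u : Fin b → Fin L → Bool)
    (v v' : Fin L → Bool) :
    Function.extend (bobQubits R) v' (memLabel R s u v) = memLabel R s u v' := by
  ext q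
  by_cases h : ∃ a, bobQubits R a = q
  · obtain ⟨a, rfl⟩ := h
    rw [(bobQubits R).injective.extend_apply]
    exact (memLabel_apply R s u v' (.inr (.inr a))).symm
  · rw [Function.extend_apply' _ _ _ h]
    by_cases hq : ∃ p, R p = q
    · obtain ⟨p, rfl⟩ := hq
      rw [memLabel_apply, memLabel_apply]
      rcases p with p | p | p
      · rfl
      · rfl
      · exact absurd ⟨p, rfl⟩ h
    · rw [memLabel_apply_of_notMem _ _ _ _ hq, memLabel_apply_of_notMem _ _ _ _ hq]

lemma extend_aliceQubits (R : Slot b L ↪ Fin S) (s u u' : Fin b → Fin L → Bool)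
    (v : Fin L → Bool) :
    Function.extend (aliceQubits R) (fun p => u' p.1 p.2) (memLabel R s u v) =
      memLabel R s u' v := by
  ext q
  by_cases h : ∃ a, aliceQubits R a = q
  · obtain ⟨a, rfl⟩ := h
    rw [(aliceQubits R).injective.extend_apply]
    exact (memLabel_apply R s u' v (.inr (.inl a))).symm
  · rw [Function.extend_apply' _ _ _ h]
    by_cases hq : ∃ p, R p = q
    · obtain ⟨p, rfl⟩ := hq
      rw [memLabel_apply, memLabel_apply]
      rcases p with p | p | p
      · rfl
      · exact absurd ⟨p, rfl⟩ h
      · rfl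
    · rw [memLabel_apply_of_notMem _ _ _ _ hq, memLabel_apply_of_notMem _ _ _ _ hq]

variable {F : Type*} [Field F]

/-- The basis states in which all registers contain encoded elements of `F`. -/
noncomputable def encLabel (R : Slot b L ↪ Fin S) (e : F ↪ (Fin L → Bool)) :
    (Fin b → F) × (Fin b → F) × F ↪ BasisLabel S where
  toFun p := memLabel R (fun i => e (p.1 i)) (fun i => e (p.2.1 i)) (e p.2.2)
  inj' := by
    rintro ⟨s, u, v⟩ ⟨s', u', v'⟩ h
    have h' (p : Slot b L) := congrFun h (R p)
    simp only [memLabel_apply] at h'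
    refine Prod.ext ?_ (Prod.ext ?_ ?_)
    · exact funext fun i => e.injective (funext fun a => h' (.inl (i, a)))
    · exact funext fun i => e.injective (funext fun a => h' (.inr (.inl (i, a))))
    · exact e.injective (funext fun a => h' (.inr (.inr a)))

/-- The products of the entries are added to the accumulators. -/
def mulAdd (F : Type*) [Field F] (b : ℕ) : Equiv.Perm ((Fin b → F) × (Fin b → F) × F) where
  toFun p := (fun i => p.1 i + p.2.1 i * p.2.2, p.2)
  invFun p := (fun i => p.1 i - p.2.1 i * p.2.2, p.2)
  left_inv p := by simp
  right_inv p := by simp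

/-- The multiplication and addition on encoded elements, as a permutation of the basis states. -/
noncomputable def mulAddPerm (R : Slot b L ↪ Fin S) (e : F ↪ (Fin L → Bool)) :
    Equiv.Perm (BasisLabel S) :=
  (mulAdd F b).viaEmbedding (encLabel R e)

lemma mulAddPerm_apply (R : Slot b L ↪ Fin S) (e : F ↪ (Fin L → Bool)) (s u : Fin b → F) (v : F) :
    mulAddPerm R e (memLabel R (fun i => e (s i)) (fun i => e (u i)) (e v)) =
      memLabel R (fun i => e (s i + u i * v)) (fun i => e (u i)) (e v) :=
  Equiv.Perm.viaEmbedding_apply (mulAdd F b) (encLabel R e) (s, u, v)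

/-- The permutation that sets all accumulators from the string `0` to the encoding of `0`. -/
noncomputable def initPerm (R : Slot b L ↪ Fin S) (e : F ↪ (Fin L → Bool)) :
    Equiv.Perm (BasisLabel S) :=
  open Classical in
  Equiv.swap (fun _ => false) (memLabel R (fun _ => e 0) (fun _ _ => false) fun _ => false)

variable {n l r : ℕ} (R : Slot b L ↪ Fin S) (e : F ↪ (Fin L → Bool))

/-- The gates of a block are for the inner product problem. -/
abbrev PairGate (S n l r L : ℕ) := CommGate S (InputPos n l r L) (Fin l × Fin r) L

/-- Alice takes over all qubits, and the accumulators are set to zero. -/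
noncomputable def initGates (n l r : ℕ) : List (PairGate S n l r L) :=
  (Finset.univ.toList.flatMap fun q => [fresh .alice q]) ++ [permGate .alice (initPerm R e)]

/-- Bob sends the entry `t` of the vector `j`, Alice reads the entries `t` of the vectors `ρ i`,
and the products are added to the accumulators. -/
noncomputable def stepGates (ρ : Fin b → Fin l) (j : Fin r) (t : Fin n) :
    List (PairGate S n l r L) :=
  (Finset.univ.toList.flatMap fun a => [fresh .bob (bobQubits R a),
    query .bob (bobQubits R a) ∅ fun _ => some ((j, t, a) : Fin r × Fin n × Fin L),
    send (bobQubits R a)]) ++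
  (Finset.univ.toList.flatMap fun p => [fresh .alice (aliceQubits R p),
    query .alice (aliceQubits R p) ∅ fun _ => some ((ρ p.1, t, p.2) : Fin l × Fin n × Fin L)]) ++
  [permGate .alice (mulAddPerm R e)]

/-- The accumulators in the list `outs` are put out. -/
def outputGates (ρ : Fin b → Fin l) (j : Fin r) (outs : List (Fin b)) :
    List (PairGate S n l r L) :=
  outs.map fun i => output .alice (accReg R i) (ρ i, j)

/-- The circuit for the inner products of the vectors `ρ i` of Alice with the vector `j` of Bob,
which are put out for the indices `i` in `outs`. -/
noncomputable def blockGates (n : ℕ) (ρ : Fin b → Fin l) (j : Fin r) (outs : List (Fin b)) :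
    List (PairGate S n l r L) :=
  initGates R e n l r ++ (List.finRange n).flatMap (stepGates R e ρ j) ++ outputGates R ρ j outs

variable (x : Fin l → Fin n → F) (y : Fin r → Fin n → F)

/-- The correct outputs. -/
def target (k : Fin l × Fin r) : Fin L → Bool := e (innerProd (x k.1) (y k.2))

lemma extend_const_self {ι α β : Type*} (f : ι ↪ α) (c : β) :
    Function.extend f (fun _ => c) (fun _ => c) = fun _ => c := by
  ext q
  by_cases h : ∃ a, f a = q
  · obtain ⟨a, rfl⟩ := h
    rw [f.injective.extend_apply]
  · rw [Function.extend_apply' _ _ _ h]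

lemma runs_initGates (own : Fin S → Player) (z : BasisLabel S) :
    Runs (inputBits e x y) (target e x y) (initGates R e n l r) own z (fun _ => .alice)
      (memLabel R (fun _ => e 0) (fun _ _ => false) fun _ => false) := by
  have h := runs_flatMap (x := inputBits e x y) (o := target e x y)
    (Function.Embedding.refl (Fin S)) (fun q => [fresh .alice q]) .alice (fun _ => false)
    (fun q own z => runs_fresh _ _ _ _) own z
  have hid {β : Type} (f g : Fin S → β) :
      Function.extend (Function.Embedding.refl (Fin S)) f g = f :=
    funext fun q => (Function.Embedding.refl (Fin S)).injective.extend_apply f g q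
  rw [hid, hid] at h
  refine h.append ?_
  have h2 := runs_permGate (x := inputBits e x y) (o := target e x y) .alice (initPerm R e)
    fun _ => false
  rwa [initPerm, Equiv.swap_apply_left] at h2

lemma runs_stepGates (ρ : Fin b → Fin l) (j : Fin r) (t : Fin n) (s : Fin b → F)
    (u : Fin b → Fin L → Bool) (v : Fin L → Bool) :
    Runs (inputBits e x y) (target e x y) (stepGates R e ρ j t) (fun _ => .alice)
      (memLabel R (fun i => e (s i)) u v) (fun _ => .alice)
      (memLabel R (fun i => e (s i + x (ρ i) t * y j t)) (fun i => e (x (ρ i) t)) (e (y j t))) := by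
  have h1 := runs_flatMap (x := inputBits e x y) (o := target e x y) (bobQubits R)
    (fun a => [fresh .bob (bobQubits R a),
      query .bob (bobQubits R a) ∅ fun _ => some ((j, t, a) : Fin r × Fin n × Fin L),
      send (bobQubits R a)]) .alice (e (y j t))
    (fun a own z => by
      have h := ((runs_fresh (x := inputBits e x y) (o := target e x y) .bob (bobQubits R a)
        own z).append (runs_query .bob (bobQubits R a) ((j, t, a) : Fin r × Fin n × Fin L)
          (by simp) (by simp))).append (runs_send (bobQubits R a) _ _)
      simpa [inputBits, Player.other] using h) (fun _ => .alice) (memLabel R (fun i => e (s i)) u v)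
  have h2 := runs_flatMap (x := inputBits e x y) (o := target e x y) (aliceQubits R)
    (fun p => [fresh .alice (aliceQubits R p),
      query .alice (aliceQubits R p) ∅ fun _ => some ((ρ p.1, t, p.2) : Fin l × Fin n × Fin L)])
    .alice (fun p => e (x (ρ p.1) t) p.2)
    (fun p own z => by
      have h := (runs_fresh (x := inputBits e x y) (o := target e x y) .alice (aliceQubits R p)
        own z).append (runs_query .alice (aliceQubits R p)
          ((ρ p.1, t, p.2) : Fin l × Fin n × Fin L) (by simp) (by simp))
      simpa [inputBits] using h) (fun _ => .alice) (memLabel R (fun i => e (s i)) u (e (y j t)))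
  rw [extend_const_self, extend_bobQubits] at h1
  rw [extend_const_self, extend_aliceQubits R _ u (fun i => e (x (ρ i) t))] at h2
  have h3 := runs_permGate (x := inputBits e x y) (o := target e x y) .alice (mulAddPerm R e)
    (memLabel R (fun i => e (s i)) (fun i => e (x (ρ i) t)) (e (y j t)))
  rw [mulAddPerm_apply] at h3
  exact (h1.append h2).append h3

lemma runs_flatMap_stepGates (ρ : Fin b → Fin l) (j : Fin r) (ts : List (Fin n)) (s : Fin b → F)
    (u : Fin b → Fin L → Bool) (v : Fin L → Bool) :
    ∃ u' v', Runs (inputBits e x y) (target e x y) (ts.flatMap (stepGates R e ρ j))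
      (fun _ => .alice) (memLabel R (fun i => e (s i)) u v) (fun _ => .alice)
      (memLabel R (fun i => e (s i + (ts.map fun t => x (ρ i) t * y j t).sum)) u' v') := by
  induction ts generalizing s u v with
  | nil => exact ⟨u, v, by simpa using Runs.nil _ _⟩
  | cons t ts ih =>
    obtain ⟨u', v', h⟩ := ih (fun i => s i + x (ρ i) t * y j t) (fun i => e (x (ρ i) t)) (e (y j t))
    refine ⟨u', v', ?_⟩
    simp only [List.map_cons, List.sum_cons, ← add_assoc]
    exact (runs_stepGates R e x y ρ j t s u v).append h

lemma runs_outputGates (ρ : Fin b → Fin l) (j : Fin r) {outs : List (Fin b)} (hnd : outs.Nodup)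
    {own : Fin S → Player} (hown : ∀ i ∈ outs, ∀ a, own (accReg R i a) = .alice)
    {z : BasisLabel S} (hz : ∀ i ∈ outs, ∀ a, z (accReg R i a) = target e x y (ρ i, j) a) :
    ∃ own', Runs (inputBits e x y) (target e x y) (outputGates R ρ j outs) own z own' z := by
  induction outs generalizing own with
  | nil => exact ⟨own, Runs.nil _ _⟩
  | cons i outs ih =>
    rw [List.nodup_cons] at hnd
    have h1 := runs_output (x := inputBits e x y) (o := target e x y) .alice (accReg R i) (ρ i, j)
      (hown i List.mem_cons_self) (hz i List.mem_cons_self)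
    obtain ⟨own', h2⟩ := ih hnd.2
      (own := (output .alice (accReg R i) (ρ i, j) : PairGate S n l r L).newOwner own)
      (fun i' hi' a => by
        refine (if_neg ?_).trans (hown i' (List.mem_cons_of_mem _ hi') a)
        rintro ⟨a', h⟩
        have hi : i = i' := congrArg Prod.fst ((accQubits R).injective (h : accQubits R (i, a') =
          accQubits R (i', a)))
        exact hnd.1 (hi ▸ hi'))
      (fun i' hi' => hz i' (List.mem_cons_of_mem _ hi'))
    exact ⟨own', h1.append h2⟩

lemma runs_blockGates (ρ : Fin b → Fin l) (j : Fin r) {outs : List (Fin b)} (hnd : outs.Nodup)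
    (own : Fin S → Player) (z : BasisLabel S) :
    ∃ own' z', Runs (inputBits e x y) (target e x y) (blockGates R e n ρ j outs) own z own' z' := by
  obtain ⟨u, v, h⟩ := runs_flatMap_stepGates R e x y ρ j (List.finRange n) (fun _ => 0)
    (fun _ _ => false) fun _ => false
  obtain ⟨own', h2⟩ := runs_outputGates R e x y ρ j hnd (own := fun _ => .alice)
    (z := memLabel R (fun i => e (0 + ((List.finRange n).map fun t => x (ρ i) t * y j t).sum)) u v)
    (fun _ _ _ => rfl) (fun i _ a => by
      rw [memLabel_accReg, zero_add, ← Fin.sum_univ_def]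
      rfl)
  exact ⟨own', _, ((runs_initGates R e x y own z).append h).append h2⟩

lemma outputLabels_blockGates (ρ : Fin b → Fin l) (j : Fin r) (outs : List (Fin b)) :
    outputLabels (blockGates R e n ρ j outs) = outs.map fun i => (ρ i, j) := by
  have h1 : outputLabels (initGates R e n l r) = [] := by
    rw [List.filterMap_eq_nil_iff]
    intro g hg
    simp only [initGates, List.mem_append, List.mem_flatMap, List.mem_cons, List.not_mem_nil,
      or_false] at hg
    rcases hg with ⟨_, _, rfl⟩ | rfl <;> rfl
  have h2 : outputLabels ((List.finRange n).flatMap (stepGates R e ρ j)) = [] := by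
    rw [List.filterMap_eq_nil_iff]
    simp only [List.mem_flatMap, forall_exists_index, and_imp]
    intro g t _ hg
    simp only [stepGates, List.mem_append, List.mem_flatMap, List.mem_cons, List.not_mem_nil,
      or_false] at hg
    rcases hg with (⟨_, _, rfl | rfl | rfl⟩ | ⟨_, _, rfl | rfl⟩) | rfl <;> rfl
  have h3 : outputLabels (outputGates (n := n) R ρ j outs) = outs.map fun i => (ρ i, j) := by
    rw [outputGates, outputLabels, List.filterMap_map]
    exact congrFun List.filterMap_eq_map' outs
  rw [blockGates, outputLabels, List.filterMap_append, List.filterMap_append]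
  exact (congrArg₂ _ (congrArg₂ _ h1 h2) h3).trans (by simp)

lemma sum_map_flatMap {α β : Type*} (ls : List α) (G : α → List β) (c : β → ℕ) (m : ℕ)
    (h : ∀ a ∈ ls, ((G a).map c).sum ≤ m) : ((ls.flatMap G).map c).sum ≤ ls.length * m := by
  induction ls with
  | nil => simp
  | cons a ls ih =>
    rw [List.flatMap_cons, List.map_append, List.sum_append, List.length_cons, Nat.succ_mul,
      add_comm]
    exact Nat.add_le_add (ih fun a ha => h a (List.mem_cons_of_mem _ ha))
      (h a List.mem_cons_self)

lemma cost_blockGates_le (ρ : Fin b → Fin l) (j : Fin r) (outs : List (Fin b)) :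
    ((blockGates R e n ρ j outs).map cost).sum ≤ n * L + outs.length * L := by
  have h1 : ((initGates R e n l r).map cost).sum ≤ 0 := by
    rw [initGates, List.map_append, List.sum_append]
    have := sum_map_flatMap Finset.univ.toList
      (fun q => [(fresh .alice q : PairGate S n l r L)]) cost 0 (fun _ _ => by simp [cost])
    simpa [cost, permGate] using this
  have h2 : (((List.finRange n).flatMap (stepGates R e ρ j)).map cost).sum ≤ n * L := by
    have := sum_map_flatMap (List.finRange n) (stepGates (S := S) (n := n) R e ρ j) cost L
      (fun t _ => by
        rw [stepGates, List.map_append, List.map_append, List.sum_append, List.sum_append]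
        have h3 := sum_map_flatMap Finset.univ.toList
          (fun a => [(fresh .bob (bobQubits R a) : PairGate S n l r L),
            query .bob (bobQubits R a) ∅ fun _ => some ((j, t, a) : Fin r × Fin n × Fin L),
            send (bobQubits R a)]) cost 1 (fun _ _ => by simp [cost])
        have h4 := sum_map_flatMap Finset.univ.toList
          (fun p => [(fresh .alice (aliceQubits R p) : PairGate S n l r L),
            query .alice (aliceQubits R p) ∅ fun _ =>
              some ((ρ p.1, t, p.2) : Fin l × Fin n × Fin L)]) cost 0 (fun _ _ => by simp [cost])
        have h5 : ([(permGate .alice (mulAddPerm R e) : PairGate S n l r L)].map cost).sum = 0 :=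
          rfl
        simp only [Finset.length_toList, Finset.card_univ, Fintype.card_fin, mul_one,
          mul_zero] at h3 h4
        omega)
    simpa using this
  have h3 : ((outputGates (S := S) (n := n) R ρ j outs).map cost).sum = outs.length * L := by
    have h4 : (cost ∘ fun i => (output .alice (accReg R i) (ρ i, j) : PairGate S n l r L)) =
        fun _ => L := rfl
    rw [outputGates, List.map_map, h4, List.map_const', List.sum_replicate, smul_eq_mul]
  rw [blockGates, List.map_append, List.map_append, List.sum_append, List.sum_append, h3]
  omega

end BlockCircuit

end CommGate

/-! ### The upper bound -/

section UpperBound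

open CommGate

variable {F : Type*} [Field F] {n r S b : ℕ}

/-- Row `i` of block `m`, if there is such a row. -/
def blockRow (b : ℕ) (hn : 1 ≤ n) (m : ℕ) (i : Fin b) : Fin n :=
  if h : m * b + i < n then ⟨m * b + i, h⟩ else ⟨0, hn⟩

/-- The indices in block `m` that belong to rows. -/
def blockOuts (n b m : ℕ) : List (Fin b) := (List.finRange b).filter fun i => m * b + i < n

lemma mem_blockOuts {m : ℕ} {i : Fin b} : i ∈ blockOuts n b m ↔ m * b + i < n := by
  simp [blockOuts]

/-- The gates of a protocol with a block of `b` rows at a time. -/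
noncomputable def protocolGates (r : ℕ) (hn : 1 ≤ n) {L : ℕ} (R : Slot b L ↪ Fin S)
    (e : F ↪ (Fin L → Bool)) : List (PairGate S n n r L) :=
  (List.finRange r ×ˢ List.finRange (n / b + 1)).flatMap fun p =>
    blockGates R e n (blockRow b hn p.2) p.1 (blockOuts n b p.2)

lemma outputLabels_protocolGates (hn : 1 ≤ n) {L : ℕ} (R : Slot b L ↪ Fin S)
    (e : F ↪ (Fin L → Bool)) : outputLabels (protocolGates r hn R e) =
      (List.finRange r ×ˢ List.finRange (n / b + 1)).flatMap fun p =>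
        (blockOuts n b p.2).map fun i => (blockRow b hn p.2 i, p.1) := by
  rw [outputLabels, protocolGates, List.filterMap_flatMap]
  exact List.flatMap_congr fun p _ => outputLabels_blockGates R e _ _ _

lemma nodup_outputLabels_protocolGates (hn : 1 ≤ n) {L : ℕ} (R : Slot b L ↪ Fin S)
    (e : F ↪ (Fin L → Bool)) : (outputLabels (protocolGates r hn R e)).Nodup := by
  rw [outputLabels_protocolGates, List.nodup_flatMap]
  have hrow {m : ℕ} {i : Fin b} (hi : i ∈ blockOuts n b m) :
      (blockRow b hn m i : ℕ) = m * b + i := by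
    rw [blockRow, dif_pos (mem_blockOuts.1 hi)]
  constructor
  · rintro ⟨j, m⟩ -
    refine List.Nodup.map_on (fun i hi i' hi' h => ?_) ((List.nodup_finRange b).filter _)
    have := congrArg (fun p : Fin n × Fin r => (p.1 : ℕ)) h
    simp only [hrow hi, hrow hi'] at this
    exact Fin.ext (by omega)
  · refine ((List.nodup_finRange r).product (List.nodup_finRange _)).imp ?_
    rintro ⟨j, m⟩ ⟨j', m'⟩ hne k hk hk'
    simp only [List.mem_map] at hk hk'
    obtain ⟨i, hi, rfl⟩ := hk
    obtain ⟨i', hi', h⟩ := hk'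
    have h1 := congrArg (fun p : Fin n × Fin r => (p.1 : ℕ)) h
    simp only [hrow hi, hrow hi'] at h1
    have hb : 0 < b := i.pos
    have hdiv (m : ℕ) (i : Fin b) : (m * b + i) / b = m := by
      rw [mul_comm, Nat.mul_add_div hb, Nat.div_eq_of_lt i.2, add_zero]
    have h2 := congrArg (· / b) h1
    simp only [hdiv] at h2
    exact hne (Prod.ext (congrArg Prod.snd h).symm (Fin.ext h2.symm))

lemma mem_outputLabels_protocolGates (hn : 1 ≤ n) (hb : 1 ≤ b) {L : ℕ} (R : Slot b L ↪ Fin S)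
    (e : F ↪ (Fin L → Bool)) (k : Fin n × Fin r) : k ∈ outputLabels (protocolGates r hn R e) := by
  obtain ⟨⟨i, hi⟩, j⟩ := k
  rw [outputLabels_protocolGates, List.mem_flatMap]
  have hib : i / b * b + i % b = i := by rw [mul_comm]; exact Nat.div_add_mod i b
  refine ⟨(j, ⟨i / b, Nat.lt_succ_of_le (Nat.div_le_div_right hi.le)⟩), by simp, ?_⟩
  refine List.mem_map.2 ⟨⟨i % b, Nat.mod_lt _ hb⟩, mem_blockOuts.2 ?_, ?_⟩
  · simpa [hib] using hi
  · simp [blockRow, hib, hi]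

lemma runs_protocolGates (hn : 1 ≤ n) {L : ℕ} (R : Slot b L ↪ Fin S)
    (e : F ↪ (Fin L → Bool)) (x : Fin n → Fin n → F) (y : Fin r → Fin n → F)
    (own : Fin S → Player) (z : BasisLabel S) :
    ∃ own' z', Runs (inputBits e x y) (target e x y) (protocolGates r hn R e) own z own' z' := by
  rw [protocolGates]
  generalize List.finRange r ×ˢ List.finRange (n / b + 1) = ps
  induction ps generalizing own z with
  | nil => exact ⟨own, z, Runs.nil _ _⟩
  | cons p ps ih =>
    obtain ⟨own', z', h⟩ := runs_blockGates R e x y (blockRow b hn p.2) p.1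
      ((List.nodup_finRange b).filter _ : (blockOuts n b p.2).Nodup) own z
    obtain ⟨own'', z'', h'⟩ := ih own' z'
    exact ⟨own'', z'', h.append h'⟩

lemma cost_protocolGates_le (hn : 1 ≤ n) {L : ℕ} (R : Slot b L ↪ Fin S)
    (e : F ↪ (Fin L → Bool)) :
    ((protocolGates r hn R e).map cost).sum ≤ r * (n / b + 1) * ((n + b) * L) := by
  have h := sum_map_flatMap (List.finRange r ×ˢ List.finRange (n / b + 1))
    (fun p => blockGates R e n (blockRow b hn p.2) p.1 (blockOuts n b p.2)) cost ((n + b) * L)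
    (fun p _ => (cost_blockGates_le R e _ _ _).trans (by
      rw [add_mul]
      gcongr
      exact (List.length_filter_le _ _).trans_eq (List.length_finRange)))
  rw [List.length_product, List.length_finRange, List.length_finRange] at h
  exact h

variable [Fintype F]

/-- The inner products of `n` vectors of Alice with `r` vectors of Bob can be computed in blocks of
`b` rows. -/
lemma exists_deterministic_protocol (hn : 1 ≤ n) (hb : 1 ≤ b)
    (hS : (2 * b + 1) * elemBits F ≤ S) (e : F ↪ (Fin (elemBits F) → Bool)) :
    ∃ π : PairProtocol F n n r S, π.IsDeterministic ∧ π.Computes e 1 ∧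
      π.communication ≤ r * (n / b + 1) * ((n + b) * elemBits F) := by
  obtain ⟨R⟩ : Nonempty (Slot b (elemBits F) ↪ Fin S) :=
    Function.Embedding.nonempty_of_card_le (by
      simp only [Fintype.card_sum, Fintype.card_prod, Fintype.card_fin]
      linarith)
  obtain ⟨own, z, h⟩ := runs_protocolGates (r := r) hn R e 0 0 (fun _ => .alice) fun _ => false
  refine ⟨⟨fun _ => .alice, protocolGates r hn R e, h.legal,
    nodup_outputLabels_protocolGates hn R e, mem_outputLabels_protocolGates hn hb R e⟩,
    h.classical, fun x y => ?_, cost_protocolGates_le hn R e⟩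
  obtain ⟨own', z', h'⟩ := runs_protocolGates (r := r) hn R e x y (fun _ => .alice) fun _ => false
  have h1 := h'.state
  rw [run_eq_foldl] at h1
  refine le_of_eq (Eq.trans ?_ (congrArg (fun ρ : QState S => (Matrix.trace ρ).re) h1.symm))
  simp

lemma elemBits_pos (F : Type*) [Field F] [Fintype F] : 1 ≤ elemBits F :=
  Nat.clog_pos (by norm_num) Fintype.one_lt_card

lemma elemBits_le_two_mul_logb_card (F : Type*) [Field F] [Fintype F] :
    (elemBits F : ℝ) ≤ 2 * Real.logb 2 (Fintype.card F) := by
  have h : ((elemBits F - 1 : ℕ) : ℝ) ≤ Real.logb 2 (Fintype.card F) := by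
    rw [Real.le_logb_iff_rpow_le (by norm_num) (by exact_mod_cast Fintype.card_pos),
      Real.rpow_natCast]
    exact_mod_cast (Nat.pow_pred_clog_lt_self (by norm_num) Fintype.one_lt_card).le
  rw [Nat.cast_sub (elemBits_pos F), Nat.cast_one] at h
  linarith [one_le_logb_card F]

/-- The block size for space `S`: about the largest number of rows for which the registers of `L`
bits fit into the space. -/
lemma exists_blockSize {n S L : ℕ} (hn : 1 ≤ n) (hL : 1 ≤ L) (hS : S ≤ n * L) :
    ∃ b, 1 ≤ b ∧ b ≤ n ∧ (2 * b + 1) * L ≤ max S (3 * L) ∧ S ≤ 5 * b * L := by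
  have hle := le_max_left S (3 * L)
  have hle' := le_max_right S (3 * L)
  have hmax : max S (3 * L) ≤ max n 3 * L :=
    max_le (hS.trans (Nat.mul_le_mul_right _ (le_max_left _ _)))
      (Nat.mul_le_mul_right _ (le_max_right _ _))
  generalize max S (3 * L) = S' at *
  have h1 : 3 ≤ S' / L := (Nat.le_div_iff_mul_le hL).2 hle'
  have h2 : S' / L ≤ max n 3 := Nat.div_le_of_le_mul (hmax.trans_eq (mul_comm _ _))
  have h3 : S' / L * L ≤ S' := Nat.div_mul_le_self S' L
  have h4 : S' < (S' / L + 1) * L := by rw [mul_comm]; exact Nat.lt_mul_div_succ _ hL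
  generalize S' / L = D at *
  exact ⟨(D - 1) / 2, by omega, by omega, (Nat.mul_le_mul_right L (by omega)).trans h3,
    hle.trans (h4.le.trans (Nat.mul_le_mul_right L (by omega)))⟩

lemma block_communication_le {C n r b S L : ℕ} {ℓ : ℝ} (hb : 1 ≤ b) (hbn : b ≤ n)
    (hSb : S ≤ 5 * b * L) (hS : 1 ≤ S) (hL : (L : ℝ) ≤ 2 * ℓ)
    (hC : C ≤ r * (n / b + 1) * ((n + b) * L)) :
    (C : ℝ) ≤ 80 * (n ^ 2 * r * ℓ ^ 2 / S) := by
  have hbpos : (0 : ℝ) < b := by exact_mod_cast hb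
  have hSpos : (0 : ℝ) < S := by exact_mod_cast hS
  have hbn' : (b : ℝ) ≤ n := by exact_mod_cast hbn
  have hSb' : (S : ℝ) ≤ 5 * b * L := by exact_mod_cast hSb
  have hC' : (C : ℝ) ≤ r * ((n / b : ℕ) + 1) * ((n + b) * L) := by exact_mod_cast hC
  have hdiv : ((n / b : ℕ) : ℝ) ≤ n / b := Nat.cast_div_le
  have hone : 1 ≤ (n : ℝ) / b := by rwa [one_le_div hbpos]
  calc (C : ℝ) ≤ r * ((n / b : ℕ) + 1) * ((n + b) * L) := hC'
    _ ≤ r * (n / b + n / b) * ((n + n) * L) := by gcongr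
    _ = 4 * (n ^ 2 * r * L) * (1 / b) := by ring
    _ ≤ 4 * (n ^ 2 * r * L) * (5 * L / S) := by
        gcongr 4 * (n ^ 2 * r * L) * ?_
        rw [div_le_div_iff₀ hbpos hSpos]
        linarith
    _ = 20 * (n ^ 2 * r * L ^ 2 / S) := by ring
    _ ≤ 20 * (n ^ 2 * r * (2 * ℓ) ^ 2 / S) := by gcongr
    _ = _ := by ring

/-- For every space bound, the blocks can be chosen so that the communication matches the lower
bound up to a constant. -/
theorem exists_deterministic_protocol_le (hn : 1 ≤ n) (hS : 1 ≤ S)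
    (hSn : (S : ℝ) ≤ n * Real.logb 2 (Fintype.card F)) (e : F ↪ (Fin (elemBits F) → Bool)) :
    ∃ π : PairProtocol F n n r (max S (3 * elemBits F)),
      π.IsDeterministic ∧ π.Computes e 1 ∧
      (π.communication : ℝ) ≤ 80 * (n ^ 2 * r * Real.logb 2 (Fintype.card F) ^ 2 / S) := by
  have hSnL : S ≤ n * elemBits F := by
    have h : (S : ℝ) ≤ n * elemBits F :=
      hSn.trans (mul_le_mul_of_nonneg_left (logb_card_le_elemBits F) n.cast_nonneg)
    exact_mod_cast h
  obtain ⟨b, hb, hbn, hspace, hSb⟩ := exists_blockSize hn (elemBits_pos F) hSnL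
  obtain ⟨π, h1, h2, h3⟩ := exists_deterministic_protocol (r := r) hn hb hspace e
  exact ⟨π, h1, h2,
    block_communication_le hb hbn hSb hS (elemBits_le_two_mul_logb_card F) h3⟩

end UpperBound

theorem corollary1 :
    -- upper bounds: matrix multiplication and matrix-vector multiplication
    (∃ c : ℕ, ∃ K : ℝ, ∀ (F : Type*) [Field F] [Fintype F]
      (e : F ↪ (Fin (elemBits F) → Bool)) (n S : ℕ), 1 ≤ n → 1 ≤ S →
      Real.logb 2 n ≤ S → (S : ℝ) ≤ n * Real.logb 2 (Fintype.card F) →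
      (∃ π : PairProtocol F n n n (max S (c * elemBits F)),
        π.IsDeterministic ∧ π.Computes e 1 ∧
        (π.communication : ℝ) ≤ K * (n ^ 3 * Real.logb 2 (Fintype.card F) ^ 2 / S)) ∧
      (∃ π : PairProtocol F n n 1 (max S (c * elemBits F)),
        π.IsDeterministic ∧ π.Computes e 1 ∧
        (π.communication : ℝ) ≤ K * (n ^ 2 * Real.logb 2 (Fintype.card F) ^ 2 / S))) ∧
    -- lower bounds, for every bound `ε < 1 / 2` on the error
    (∀ ε : ℝ, 0 ≤ ε → ε < 1 / 2 → ∃ δ : ℝ, 0 < δ ∧ ∀ (F : Type*) [Field F] [Fintype F]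
      (e : F ↪ (Fin (elemBits F) → Bool)) (n S : ℕ), 1 ≤ n → 1 ≤ S →
      Real.logb 2 n ≤ S → (S : ℝ) ≤ n * Real.logb 2 (Fintype.card F) →
      (∀ π : PairProtocol F n n n S, π.Computes e (1 - ε) →
        δ * (n ^ 3 * Real.logb 2 (Fintype.card F) ^ 2 / S) ≤ (π.communication : ℝ)) ∧
      (∀ π : PairProtocol F n n 1 S, π.Computes e (1 - ε) →
        δ * (n ^ 2 * Real.logb 2 (Fintype.card F) ^ 2 / S) ≤ (π.communication : ℝ))) := by
  have hcube (n : ℕ) : (n : ℝ) ^ 3 = n ^ 2 * n := pow_succ _ _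
  have hsq (n : ℕ) : (n : ℝ) ^ 2 = n ^ 2 * (1 : ℕ) := by simp
  refine ⟨⟨3, 80, fun F _ _ e n S hn hS _ hSn => ⟨?_, ?_⟩⟩, fun ε _ hε => ⟨1 / 96, by norm_num,
    fun F _ _ e n S hn hS _ _ => ⟨fun π h => ?_, fun π h => ?_⟩⟩⟩
  · rw [hcube]
    exact exists_deterministic_protocol_le hn hS hSn e
  · rw [hsq]
    exact exists_deterministic_protocol_le hn hS hSn e
  · rw [hcube]
    exact h.le_communication (by linarith) hn hn hS
  · rw [hsq]
    exact h.le_communication (by linarith) hn le_rfl hS
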